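/- Let $d\ge 1$. For a cube $Q_N\subset\mathbb R^d$ centred at the origin with edge length $N>0$ put $(\mathfrak F_Nf)(\xi)=\int_{Q_N}f(x)e^{-i(\xi,x)}\,dx$. For a measurable $g$ on $\mathbb R$ let $g^*(t)=\inf\{\rho: |\{|g|>\rho\}|\le t\}$, $t>0$, and for a measurable $f:\mathbb R^d\to\mathbb C$ let $f^{*_1\cdots *_d}$ be obtained by applying this rearrangement successively in the variables $x_1,\dots,x_d$, the others being fixed. For a function $F\ge 0$ on $(0,\infty)^d$ and $\mathbf q=(q_1,\dots,q_d)$, $0<q_i\le\infty$, let $$\Phi_{\mathbf q}(F)=\Big(\int_0^\infty\cdots\Big(\int_0^\infty F(t_1,\dots,t_d)^{q_1}\frac{dt_1}{t_1}\Big)^{q_2/q_1}\cdots\frac{dt_d}{t_d}\Big)^{1/q_d},$$ where $\big(\int_0^\infty G(t_i)^{q_i}\frac{dt_i}{t_i}\big)^{1/q_i}$ means $\sup_{t_i>0}G(t_i)$ if $q_i=\infty$. For $\mathbf p=(p_1,\dots,p_d)$ with $0<p_i<\infty$, the space $L_{\mathbf p,\mathbf q}$ consists of the measurable $f$ with $$\|f\|_{L_{\mathbf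 p,\mathbf q}}=\Phi_{\mathbf q}\big(t_1^{1/p_1}\cdots t_d^{1/p_d}\,f^{*_1\cdots *_d}(t)\big)<\infty .$$ For a locally integrable $g:\mathbb R^d\to\mathbb C$ and $t\in(0,\infty)^d$ let $$\overline g(t)=\sup\Big\{\frac1{|I_1|\cdots|I_d|}\Big|\int_I g(x)\,dx\Big| : I=I_1\times\cdots\times I_d,\ |I_i|\ge t_i\Big\},$$ the supremum being over products $I$ of bounded intervals of positive length. The net space $N_{\mathbf p,\mathbf q}$ consists of the locally integrable $g$ with $$\|g\|_{N_{\mathbf p,\mathbf q}}=\Phi_{\mathbf q}\big(t_1^{1/p_1}\cdots t_d^{1/p_d}\,\overline g(t)\big)<\infty .$$ **Theorem.** (i) Let $1<p_i<\infty$, $0<q_i\le\infty$ and $p_i'=p_i/(p_i-1)$ for $i=1,\dots,d$. There is a constant $C$, depending only on $d,\mathbf p,\mathbf q$, such that for every $N>0$ and every $f\in L_{\mathbf p,\mathbf q}$, $f$ is integrable on $Q_N$, $\mathfrak F_Nf\in N_{\mathbf p',\mathbf q}$, and $$\|\mathfrak F_Nf\|_{N_{\mathbf p',\mathbf q}}\le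 C\,\|f\|_{L_{\mathbf p,\mathbf q}} .$$ (ii) In particular, for $1<p<\infty$ there is a constant $C$, depending only on $d$ and $p$, such that for every $N>0$ and every $f\in L_p(\mathbb R^d)$, $$\Big(\int_0^\infty\cdots\int_0^\infty (t_1\cdots t_d)^{p-2}\,\overline{\mathfrak F_Nf}(t_1,\dots,t_d)^p\,dt_1\cdots dt_d\Big)^{1/p}\le C\,\|f\|_{L_p(\mathbb R^d)} .$$ -/

import Mathlib

open MeasureTheory
open scoped ENNReal NNReal

noncomputable section

/-- The non-increasing rearrangement `g^*(t) = inf {ρ : |{g > ρ}| ≤ t}`, for `t > 0`, of a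
function `g = |f|` of one variable (the infimum of the empty set of finite `ρ` is `∞`). -/
def rearr (g : ℝ → ℝ≥0∞) (t : ℝ) : ℝ≥0∞ :=
  sInf {ρ : ℝ≥0∞ | volume {x : ℝ | ρ < g x} ≤ ENNReal.ofReal t}

/-- The iterated rearrangement `F^{*_1 ⋯ *_d}`: first in the first variable with the others fixed,
then in the second one, and so on; the last variable is rearranged last. -/
def iterRearr : (d : ℕ) → ((Fin d → ℝ) → ℝ≥0∞) → (Fin d → ℝ) → ℝ≥0∞
  | 0, F => F
  | d + 1, F => fun t =>
      rearr (fun s => iterRearr d (fun x => F (Fin.snoc (α := fun _ => ℝ) x s)) (Fin.init t))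
        (t (Fin.last d))

/-- `(∫_0^∞ g(t)^q dt/t)^{1/q}` for `0 < q < ∞`, and `sup_{t > 0} g(t)` for `q = ∞`. -/
def haarNorm (q : ℝ≥0∞) (g : ℝ → ℝ≥0∞) : ℝ≥0∞ :=
  if q = ∞ then ⨆ t : ℝ, ⨆ _ : 0 < t, g t
  else (∫⁻ t in Set.Ioi (0 : ℝ), g t ^ q.toReal / ENNReal.ofReal t) ^ (1 / q.toReal)

/-- The mixed norm
`(∫_0^∞ ⋯ (∫_0^∞ F(t_1, …, t_d)^{q_1} dt_1/t_1)^{q_2/q_1} ⋯ dt_d/t_d)^{1/q_d}`,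
innermost in the first variable and outermost in the last one. -/
def mixedNorm : (d : ℕ) → (Fin d → ℝ≥0∞) → ((Fin d → ℝ) → ℝ≥0∞) → ℝ≥0∞
  | 0, _, F => F Fin.elim0
  | d + 1, q, F =>
      haarNorm (q (Fin.last d)) fun s =>
        mixedNorm d (Fin.init q) fun x => F (Fin.snoc (α := fun _ => ℝ) x s)

/-- The weight `t_1^{1/p_1} ⋯ t_d^{1/p_d}`. -/
def powerWeight {d : ℕ} (p : Fin d → ℝ) (t : Fin d → ℝ) : ℝ≥0∞ :=
  ∏ i, ENNReal.ofReal (t i) ^ (1 / p i)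

/-- The (quasi-)norm of the anisotropic Lorentz space `L_{p,q}(ℝ^d)`. -/
def lorentzNorm {d : ℕ} (p : Fin d → ℝ) (q : Fin d → ℝ≥0∞) (f : (Fin d → ℝ) → ℂ) : ℝ≥0∞ :=
  mixedNorm d q fun t => powerWeight p t * iterRearr d (fun x => ‖f x‖ₑ) t

/-- `f ∈ L_{p,q}(ℝ^d)`: `f` is Lebesgue measurable with finite norm. -/
def MemLorentz {d : ℕ} (p : Fin d → ℝ) (q : Fin d → ℝ≥0∞) (f : (Fin d → ℝ) → ℂ) : Prop :=
  AEMeasurable f volume ∧ lorentzNorm p q f < ∞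

/-- The average function
`sup { |I_1|⁻¹ ⋯ |I_d|⁻¹ |∫_I f| : I = I_1 × ⋯ × I_d, |I_i| ≥ t_i }`, over all bounded
axis-parallel rectangles `I = ∏ [a_i, b_i]` of positive measure (whether end points
belong to the sides does not matter for the integrals). -/
def netAverage {d : ℕ} (f : (Fin d → ℝ) → ℂ) (t : Fin d → ℝ) : ℝ≥0∞ :=
  ⨆ (a : Fin d → ℝ) (b : Fin d → ℝ) (_ : ∀ i, a i < b i ∧ t i ≤ b i - a i),
    ENNReal.ofReal ((∏ i, (b i - a i))⁻¹ * ‖∫ x in Set.Icc a b, f x‖)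

/-- The norm of the net space `N_{p,q}`. -/
def netNorm {d : ℕ} (p : Fin d → ℝ) (q : Fin d → ℝ≥0∞) (f : (Fin d → ℝ) → ℂ) : ℝ≥0∞ :=
  mixedNorm d q fun t => powerWeight p t * netAverage f t

/-- `f ∈ N_{p,q}`: `f` is measurable and integrable on every bounded rectangle (so that its
averages make sense), and its norm is finite. -/
def MemNet {d : ℕ} (p : Fin d → ℝ) (q : Fin d → ℝ≥0∞) (f : (Fin d → ℝ) → ℂ) : Prop :=
  AEMeasurable f volume ∧ LocallyIntegrable f volume ∧ netNorm p q f < ∞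

/-- The cube centred at the origin with edge length `N`. -/
def centredCube (d : ℕ) (N : ℝ) : Set (Fin d → ℝ) :=
  Set.Icc (fun _ => -(N / 2)) (fun _ => N / 2)

/-- The truncated Fourier transform `ξ ↦ ∫_{Q_N} f(x) e^{-i(ξ,x)} dx`. -/
def truncFourier {d : ℕ} (N : ℝ) (f : (Fin d → ℝ) → ℂ) (ξ : Fin d → ℝ) : ℂ :=
  ∫ x in centredCube d N, f x * Complex.exp (-Complex.I * ((∑ i, ξ i * x i : ℝ) : ℂ))

end

/-!
The average of the Fourier transform of `f` over a rectangle `I` is the integral of `f` against the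
normalized Fourier transform of the indicator of `I`, and the latter is at most
`∏ min(1, 2 / (|I_i| |x_i|))` (`netAverage_truncFourier_le`). The supremum over all `|I_i| ≥ t_i`
is therefore at most `∫ |f(x)| ∏ min(1, 2 / (t_i |x_i|)) dx`, in which neither `I` nor the cube
`Q_N` appears any more. A Hardy–Littlewood inequality, applied in one variable after the other
(`lintegral_mul_prod_decayWeight_le`), bounds this integral by a sum of dyadic values of the
iterated rearrangement. After multiplication by the power weight the sum becomes
`∑_{j, i ∈ ℕ^d} ∏ 2^{-j/p - i/p'} b(j - i - n)`, with `t = 2^n` and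
`b(k) = 2^{k/p} f^{*_1⋯*_d}(2^k)`: a convolution whose coefficients decay geometrically, because
`1 < p < ∞`. The norm being invariant under translations and reflections, and its `r`-th power
countably subadditive for small `r`, this gives the bound for all `0 < q ≤ ∞`
(`dyadicNorm_lintegral_decayWeight_le`).

Everything takes place in iterated `ℓ^q` norms over `ℤ^d`. Both the rearrangement and the average
function are antitone, so that their mixed norms are comparable with the norms of their values at
dyadic points; in this way no measurability of partial mixed norms is ever needed, not even for the
uncountable suprema of `q = ∞`. For `p = q` the discrete norm of the rearrangement is bounded by
the `L_p` norm (`dyadicNorm_iterRearr_le_eLpNorm`), a consequence of the layer cake formula.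
-/

/-! ### Iterated sequence norms -/

/-- Minkowski's inequality in `ℓ^p`, for sums of arbitrary families of sequences. -/
lemma ENNReal.Lp_tsum_le {ι κ : Type*} (b : κ → ι → ℝ≥0∞) {p : ℝ} (hp : 1 ≤ p) :
    (∑' n, (∑' k, b k n) ^ p) ^ (1 / p) ≤ ∑' k, (∑' n, b k n ^ p) ^ (1 / p) := by
  classical
  have hp0 : 0 < p := by linarith
  have hfin : ∀ (T : Finset ι) (S : Finset κ),
      (∑ n ∈ T, (∑ k ∈ S, b k n) ^ p) ^ (1 / p) ≤ ∑ k ∈ S, (∑ n ∈ T, b k n ^ p) ^ (1 / p) := by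
    intro T S
    induction S using Finset.induction_on with
    | empty => simp [hp0]
    | insert a S ha ih =>
      simp only [Finset.sum_insert ha]
      exact (ENNReal.Lp_add_le T _ _ hp).trans (by gcongr)
  rw [one_div, ENNReal.rpow_inv_le_iff hp0, ENNReal.tsum_eq_iSup_sum]
  refine iSup_le fun T => ?_
  rw [← ENNReal.rpow_inv_le_iff hp0, ← one_div]
  have ht : Filter.Tendsto (fun S : Finset κ => (∑ n ∈ T, (∑ k ∈ S, b k n) ^ p) ^ (1 / p))
      Filter.atTop (nhds ((∑ n ∈ T, (∑' k, b k n) ^ p) ^ (1 / p))) := by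
    refine (ENNReal.continuous_rpow_const.tendsto _).comp (tendsto_finsetSum _ fun n _ => ?_)
    exact (ENNReal.continuous_rpow_const.tendsto _).comp ENNReal.summable.hasSum
  refine le_of_tendsto ht (Filter.Eventually.of_forall fun S => (hfin T S).trans ?_)
  refine (Finset.sum_le_sum fun k _ => ?_).trans (ENNReal.sum_le_tsum S)
  gcongr
  exact ENNReal.sum_le_tsum T

/-- The (quasi-)norm of `ℓ^q(ℤ)`, for `0 < q ≤ ∞`. -/
noncomputable def seqNorm (q : ℝ≥0∞) (a : ℤ → ℝ≥0∞) : ℝ≥0∞ :=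
  if q = ∞ then ⨆ n, a n else (∑' n, a n ^ q.toReal) ^ (1 / q.toReal)

/-- The iterated `ℓ^q` norm on `ℤ^d`, the discrete counterpart of `mixedNorm`: innermost in the
first variable and outermost in the last one. -/
noncomputable def dyadicNorm :
    (d : ℕ) → (Fin d → ℝ≥0∞) → ((Fin d → ℤ) → ℝ≥0∞) → ℝ≥0∞
  | 0, _, A => A Fin.elim0
  | d + 1, q, A =>
      seqNorm (q (Fin.last d)) fun n =>
        dyadicNorm d (Fin.init q) fun k => A (Fin.snoc (α := fun _ => ℤ) k n)

lemma seqNorm_top (a : ℤ → ℝ≥0∞) : seqNorm ∞ a = ⨆ n, a n := if_pos rfl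

lemma seqNorm_of_ne_top {q : ℝ≥0∞} (hq : q ≠ ∞) (a : ℤ → ℝ≥0∞) :
    seqNorm q a = (∑' n, a n ^ q.toReal) ^ (1 / q.toReal) := if_neg hq

lemma seqNorm_mono {q : ℝ≥0∞} {a b : ℤ → ℝ≥0∞} (h : ∀ n, a n ≤ b n) :
    seqNorm q a ≤ seqNorm q b := by
  rcases eq_or_ne q ∞ with rfl | hq
  · simpa only [seqNorm_top] using iSup_mono h
  · simp only [seqNorm_of_ne_top hq]
    have h0 : 0 ≤ q.toReal := ENNReal.toReal_nonneg
    gcongr with n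
    exact h n

lemma seqNorm_const_mul {q : ℝ≥0∞} (hq : 0 < q) (c : ℝ≥0∞) (a : ℤ → ℝ≥0∞) :
    seqNorm q (fun n => c * a n) = c * seqNorm q a := by
  rcases eq_or_ne q ∞ with rfl | hq'
  · simp only [seqNorm_top, ENNReal.mul_iSup]
  · have h0 : 0 < q.toReal := ENNReal.toReal_pos hq.ne' hq'
    simp only [seqNorm_of_ne_top hq', ENNReal.mul_rpow_of_nonneg _ _ h0.le, ENNReal.tsum_mul_left]
    rw [ENNReal.mul_rpow_of_nonneg _ _ (by positivity), ← ENNReal.rpow_mul,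
      mul_one_div_cancel h0.ne', ENNReal.rpow_one]

lemma seqNorm_comp_equiv (q : ℝ≥0∞) (e : ℤ ≃ ℤ) (a : ℤ → ℝ≥0∞) :
    seqNorm q (fun n => a (e n)) = seqNorm q a := by
  rcases eq_or_ne q ∞ with rfl | hq
  · simp only [seqNorm_top]
    exact e.iSup_comp
  · simp only [seqNorm_of_ne_top hq]
    rw [e.tsum_eq (fun n => a n ^ q.toReal)]

lemma le_seqNorm {q : ℝ≥0∞} (hq : 0 < q) (a : ℤ → ℝ≥0∞) (n : ℤ) : a n ≤ seqNorm q a := by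
  rcases eq_or_ne q ∞ with rfl | hq'
  · rw [seqNorm_top]
    exact le_iSup a n
  · have h0 : 0 < q.toReal := ENNReal.toReal_pos hq.ne' hq'
    rw [seqNorm_of_ne_top hq', one_div, ENNReal.le_rpow_inv_iff h0]
    exact ENNReal.le_tsum n

/-- Minkowski's inequality for the norm `‖|a|^r‖_{ℓ^{q/r}}`. -/
lemma seqNorm_rpow_tsum_le {κ : Type*} {q : ℝ≥0∞} {r : ℝ} (hr : 0 < r)
    (hrq : ENNReal.ofReal r ≤ q) (a : κ → ℤ → ℝ≥0∞) :
    seqNorm q (fun n => (∑' k, a k n ^ r) ^ (1 / r)) ^ r ≤ ∑' k, seqNorm q (a k) ^ r := by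
  rcases eq_or_ne q ∞ with rfl | hq
  · simp only [seqNorm_top]
    rw [← ENNReal.le_rpow_inv_iff hr]
    refine iSup_le fun n => ?_
    rw [one_div]
    gcongr with k
    exact le_iSup (a k) n
  · have hrq' : r ≤ q.toReal := (ENNReal.ofReal_le_iff_le_toReal hq).1 hrq
    have h0 : 0 < q.toReal := hr.trans_le hrq'
    have h1 : 1 ≤ q.toReal / r := (one_le_div hr).2 hrq'
    have e1 : 1 / q.toReal * r = 1 / (q.toReal / r) := by field_simp
    have e2 : 1 / r * q.toReal = q.toReal / r := by field_simp
    have e3 : r * (q.toReal / r) = q.toReal := by field_simp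
    have := ENNReal.Lp_tsum_le (fun k n => a k n ^ r) h1
    simpa only [seqNorm_of_ne_top hq, ← ENNReal.rpow_mul, e1, e2, e3] using this

lemma dyadicNorm_mono {d : ℕ} {q : Fin d → ℝ≥0∞} {A B : (Fin d → ℤ) → ℝ≥0∞}
    (h : ∀ n, A n ≤ B n) : dyadicNorm d q A ≤ dyadicNorm d q B := by
  induction d with
  | zero => exact h _
  | succ d ih => exact seqNorm_mono fun n => ih fun k => h _

lemma dyadicNorm_const_mul {d : ℕ} {q : Fin d → ℝ≥0∞} (hq : ∀ i, 0 < q i) (c : ℝ≥0∞)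
    (A : (Fin d → ℤ) → ℝ≥0∞) :
    dyadicNorm d q (fun n => c * A n) = c * dyadicNorm d q A := by
  induction d with
  | zero => rfl
  | succ d ih =>
    simp only [dyadicNorm]
    rw [← seqNorm_const_mul (hq _)]
    congr 1
    ext n
    exact ih (fun i => hq _) _

lemma dyadicNorm_comp_equiv {d : ℕ} (q : Fin d → ℝ≥0∞) (e : Fin d → ℤ ≃ ℤ)
    (A : (Fin d → ℤ) → ℝ≥0∞) :
    dyadicNorm d q (fun n => A fun i => e i (n i)) = dyadicNorm d q A := by
  induction d with
  | zero => exact congrArg A (Subsingleton.elim _ _)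
  | succ d ih =>
    simp only [dyadicNorm]
    refine Eq.trans ?_ (seqNorm_comp_equiv (q (Fin.last d)) (e (Fin.last d)) _)
    congr 1
    ext n
    refine Eq.trans ?_ (ih (Fin.init q) (fun i => e i.castSucc) _)
    congr 1
    ext k
    congr 1
    ext i
    refine Fin.lastCases ?_ (fun i => ?_) i <;> simp

lemma le_dyadicNorm {d : ℕ} {q : Fin d → ℝ≥0∞} (hq : ∀ i, 0 < q i) (A : (Fin d → ℤ) → ℝ≥0∞)
    (n : Fin d → ℤ) : A n ≤ dyadicNorm d q A := by
  induction d with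
  | zero => exact (congrArg A (Subsingleton.elim _ _)).le
  | succ d ih =>
    refine le_trans ?_ (le_seqNorm (hq (Fin.last d)) _ (n (Fin.last d)))
    refine le_trans ?_ (ih (fun i => hq _) _ (Fin.init n))
    rw [Fin.snoc_init_self]

lemma ENNReal.rpow_tsum_le_tsum_rpow {κ : Type*} (a : κ → ℝ≥0∞) {r : ℝ} (hr : 0 < r)
    (hr1 : r ≤ 1) : (∑' k, a k) ^ r ≤ ∑' k, a k ^ r := by
  classical
  rw [← ENNReal.le_rpow_inv_iff hr, ENNReal.tsum_eq_iSup_sum]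
  refine iSup_le fun S => ?_
  rw [ENNReal.le_rpow_inv_iff hr]
  refine le_trans ?_ (ENNReal.sum_le_tsum S)
  induction S using Finset.induction_on with
  | empty => simp [hr]
  | insert k S hk ih =>
    rw [Finset.sum_insert hk, Finset.sum_insert hk]
    exact (ENNReal.rpow_add_le_add_rpow _ _ hr.le hr1).trans (by gcongr)

/-- For `r ≤ min(1, q_1, …, q_d)` the `r`-th power of the iterated norm is countably
subadditive. -/
lemma dyadicNorm_tsum_rpow_le {κ : Type*} {d : ℕ} {q : Fin d → ℝ≥0∞} {r : ℝ} (hr : 0 < r)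
    (hr1 : r ≤ 1) (hrq : ∀ i, ENNReal.ofReal r ≤ q i) (A : κ → (Fin d → ℤ) → ℝ≥0∞) :
    dyadicNorm d q (fun n => ∑' k, A k n) ^ r ≤ ∑' k, dyadicNorm d q (A k) ^ r := by
  induction d with
  | zero => exact ENNReal.rpow_tsum_le_tsum_rpow _ hr hr1
  | succ d ih =>
    refine le_trans ?_ (seqNorm_rpow_tsum_le hr (hrq (Fin.last d)) _)
    refine ENNReal.rpow_le_rpow (seqNorm_mono fun n => ?_) hr.le
    rw [one_div, ENNReal.le_rpow_inv_iff hr]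
    exact ih (fun i => hrq _) _

/-! ### Dyadic discretization of the mixed norm -/

lemma iUnion_Ico_two_zpow :
    ⋃ n : ℤ, Set.Ico ((2 : ℝ) ^ n) (2 ^ (n + 1)) = Set.Ioi 0 := by
  ext t
  simp only [Set.mem_iUnion, Set.mem_Ioi]
  constructor
  · rintro ⟨n, hn⟩
    exact lt_of_lt_of_le (by positivity) hn.1
  · intro ht
    exact exists_mem_Ico_zpow ht one_lt_two

lemma pairwise_disjoint_Ico_two_zpow :
    Pairwise (Function.onFun Disjoint fun n : ℤ => Set.Ico ((2 : ℝ) ^ n) (2 ^ (n + 1))) := by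
  simpa using (zpow_right_mono₀ (one_le_two (α := ℝ))).pairwise_disjoint_on_Ico_succ

lemma lintegral_Ioi_eq_tsum_dyadic (F : ℝ → ℝ≥0∞) :
    ∫⁻ t in Set.Ioi (0 : ℝ), F t = ∑' n : ℤ, ∫⁻ t in Set.Ico ((2 : ℝ) ^ n) (2 ^ (n + 1)), F t := by
  rw [← iUnion_Ico_two_zpow,
    lintegral_iUnion (fun n => measurableSet_Ico) pairwise_disjoint_Ico_two_zpow]

lemma volume_Ico_two_zpow (n : ℤ) :
    volume (Set.Ico ((2 : ℝ) ^ n) (2 ^ (n + 1))) = ENNReal.ofReal (2 ^ n) := by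
  rw [Real.volume_Ico, zpow_add_one₀ two_ne_zero]
  congr 1
  ring

lemma haarNorm_le_seqNorm {q : ℝ≥0∞} {g : ℝ → ℝ≥0∞} {h : ℤ → ℝ≥0∞}
    (H : ∀ n : ℤ, ∀ t ∈ Set.Ico ((2 : ℝ) ^ n) (2 ^ (n + 1)), g t ≤ h n) :
    haarNorm q g ≤ seqNorm q h := by
  unfold haarNorm seqNorm
  split_ifs with hq
  · refine iSup₂_le fun t ht => ?_
    obtain ⟨n, hn⟩ := exists_mem_Ico_zpow ht (one_lt_two (α := ℝ))
    exact (H n t hn).trans (le_iSup h n)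
  · have h0 : 0 ≤ q.toReal := ENNReal.toReal_nonneg
    gcongr
    rw [lintegral_Ioi_eq_tsum_dyadic]
    gcongr with n
    have hn : ENNReal.ofReal ((2 : ℝ) ^ n) ≠ 0 := by simp; positivity
    calc ∫⁻ t in Set.Ico ((2 : ℝ) ^ n) (2 ^ (n + 1)), g t ^ q.toReal / ENNReal.ofReal t
        ≤ ∫⁻ _ in Set.Ico ((2 : ℝ) ^ n) (2 ^ (n + 1)),
            h n ^ q.toReal / ENNReal.ofReal (2 ^ n) := by
          refine setLIntegral_mono' measurableSet_Ico fun t ht => ?_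
          gcongr
          · exact H n t ht
          · exact ht.1
      _ = h n ^ q.toReal := by
          rw [setLIntegral_const, volume_Ico_two_zpow, ENNReal.div_mul_cancel hn ENNReal.ofReal_ne_top]

lemma seqNorm_le_haarNorm {q : ℝ≥0∞} {g : ℝ → ℝ≥0∞} {h : ℤ → ℝ≥0∞}
    (H : ∀ n : ℤ, ∀ t ∈ Set.Ico ((2 : ℝ) ^ n) (2 ^ (n + 1)), h n ≤ g t) :
    2⁻¹ ^ (1 / q.toReal) * seqNorm q h ≤ haarNorm q g := by
  unfold haarNorm seqNorm
  split_ifs with hq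
  · simp only [hq, ENNReal.toReal_top, div_zero, ENNReal.rpow_zero, one_mul]
    refine iSup_le fun n => ?_
    refine (H n (2 ^ n) ⟨le_rfl, zpow_lt_zpow_right₀ one_lt_two (lt_add_one n)⟩).trans ?_
    exact le_iSup₂_of_le ((2 : ℝ) ^ n) (by positivity) le_rfl
  · have h0 : 0 ≤ q.toReal := ENNReal.toReal_nonneg
    rw [← ENNReal.mul_rpow_of_nonneg _ _ (by positivity), ← ENNReal.tsum_mul_left,
      lintegral_Ioi_eq_tsum_dyadic]
    gcongr with n
    have hn : ENNReal.ofReal ((2 : ℝ) ^ n) ≠ 0 := by simp; positivity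
    calc 2⁻¹ * h n ^ q.toReal
        = ∫⁻ _ in Set.Ico ((2 : ℝ) ^ n) (2 ^ (n + 1)),
            h n ^ q.toReal / ENNReal.ofReal (2 ^ (n + 1)) := by
          rw [setLIntegral_const, volume_Ico_two_zpow, zpow_add_one₀ two_ne_zero,
            ENNReal.ofReal_mul (by positivity), ENNReal.ofReal_ofNat, div_eq_mul_inv,
            ENNReal.mul_inv (Or.inl hn) (Or.inl ENNReal.ofReal_ne_top), mul_assoc,
            mul_right_comm, ENNReal.inv_mul_cancel hn ENNReal.ofReal_ne_top, one_mul, mul_comm]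
      _ ≤ ∫⁻ t in Set.Ico ((2 : ℝ) ^ n) (2 ^ (n + 1)), g t ^ q.toReal / ENNReal.ofReal t := by
          refine setLIntegral_mono' measurableSet_Ico fun t ht => ?_
          gcongr
          · exact H n t ht
          · exact ht.2.le

/-- The dyadic box `∏ [2^{n_i}, 2^{n_i+1})`. -/
def dyadicBox {d : ℕ} (n : Fin d → ℤ) : Set (Fin d → ℝ) :=
  {t | ∀ i, t i ∈ Set.Ico ((2 : ℝ) ^ n i) (2 ^ (n i + 1))}

lemma snoc_mem_dyadicBox {d : ℕ} {n : Fin d → ℤ} {t : Fin d → ℝ} {m : ℤ} {s : ℝ}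
    (ht : t ∈ dyadicBox n) (hs : s ∈ Set.Ico ((2 : ℝ) ^ m) (2 ^ (m + 1))) :
    (Fin.snoc (α := fun _ => ℝ) t s : Fin (d + 1) → ℝ) ∈
      dyadicBox (Fin.snoc (α := fun _ => ℤ) n m : Fin (d + 1) → ℤ) := by
  intro i
  refine Fin.lastCases ?_ (fun i => ?_) i
  · simpa using hs
  · simpa using ht i

lemma mixedNorm_le_dyadicNorm {d : ℕ} {q : Fin d → ℝ≥0∞} {G : (Fin d → ℝ) → ℝ≥0∞}
    {H : (Fin d → ℤ) → ℝ≥0∞} (h : ∀ n, ∀ t ∈ dyadicBox n, G t ≤ H n) :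
    mixedNorm d q G ≤ dyadicNorm d q H := by
  induction d with
  | zero => exact h _ _ fun i => i.elim0
  | succ d ih =>
    exact haarNorm_le_seqNorm fun m s hs => ih fun n t ht => h _ _ (snoc_mem_dyadicBox ht hs)

lemma dyadicNorm_le_mixedNorm {d : ℕ} {q : Fin d → ℝ≥0∞} (hq : ∀ i, 0 < q i)
    {G : (Fin d → ℝ) → ℝ≥0∞} {H : (Fin d → ℤ) → ℝ≥0∞}
    (h : ∀ n, ∀ t ∈ dyadicBox n, H n ≤ G t) :
    (∏ i, 2⁻¹ ^ (1 / (q i).toReal)) * dyadicNorm d q H ≤ mixedNorm d q G := by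
  induction d with
  | zero => simpa [dyadicNorm, mixedNorm] using h _ _ fun i => i.elim0
  | succ d ih =>
    rw [Fin.prod_univ_castSucc, mul_right_comm, mul_comm]
    simp only [dyadicNorm, mixedNorm]
    rw [← seqNorm_const_mul (hq _)]
    refine seqNorm_le_haarNorm fun m s hs => ?_
    exact ih (fun i => hq _) fun n t ht => h _ _ (snoc_mem_dyadicBox ht hs)

/-! ### Rearrangements -/

lemma rearr_antitone (g : ℝ → ℝ≥0∞) : Antitone (rearr g) := fun _ _ hst =>
  sInf_le_sInf fun _ hρ => le_trans hρ (ENNReal.ofReal_le_ofReal hst)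

lemma rearr_mono {g h : ℝ → ℝ≥0∞} (hgh : g ≤ᵐ[volume] h) (t : ℝ) : rearr g t ≤ rearr h t := by
  refine sInf_le_sInf fun ρ hρ => le_trans (measure_mono_ae ?_) hρ
  filter_upwards [hgh] with x hx h1
  exact lt_of_lt_of_le h1 hx

lemma rearr_congr_ae {g h : ℝ → ℝ≥0∞} (hgh : g =ᵐ[volume] h) (t : ℝ) :
    rearr g t = rearr h t :=
  le_antisymm (rearr_mono hgh.le t) (rearr_mono hgh.symm.le t)

/-- The infimum in the definition of the rearrangement is attained. -/
lemma volume_rearr_lt_le (g : ℝ → ℝ≥0∞) (t : ℝ) :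
    volume {x | rearr g t < g x} ≤ ENNReal.ofReal t := by
  set S := {ρ : ℝ≥0∞ | volume {x : ℝ | ρ < g x} ≤ ENNReal.ofReal t} with hS
  have hne : S.Nonempty := ⟨∞, by simp [hS]⟩
  obtain ⟨u, hu, hlim, hmem⟩ := exists_seq_tendsto_sInf hne (OrderBot.bddBelow S)
  have hEq : {x | rearr g t < g x} = ⋃ n, {x | u n < g x} := by
    ext x
    simp only [Set.mem_ofPred_eq, Set.mem_iUnion]
    constructor
    · intro hx
      exact (hlim.eventually (gt_mem_nhds hx)).exists
    · rintro ⟨n, hn⟩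
      exact lt_of_le_of_lt (sInf_le (hmem n)) hn
  have hmono : Monotone fun n => {x | u n < g x} := fun m n hmn x hx =>
    lt_of_le_of_lt (hu hmn) hx
  rw [hEq, hmono.measure_iUnion]
  exact iSup_le hmem

lemma lt_rearr_iff {g : ℝ → ℝ≥0∞} {t : ℝ} {ρ : ℝ≥0∞} :
    ρ < rearr g t ↔ ENNReal.ofReal t < volume {x | ρ < g x} := by
  rw [← not_le, ← not_le, not_iff_not]
  constructor
  · intro h
    refine le_trans (measure_mono fun x hx => ?_) (volume_rearr_lt_le g t)
    exact lt_of_le_of_lt h hx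
  · exact fun h => sInf_le h

lemma rearr_rpow (g : ℝ → ℝ≥0∞) {p : ℝ} (hp : 0 < p) (t : ℝ) :
    rearr (fun x => g x ^ p) t = rearr g t ^ p := by
  refine eq_of_forall_lt_iff fun ρ => ?_
  rw [lt_rearr_iff, ← ENNReal.rpow_inv_lt_iff hp, lt_rearr_iff]
  simp only [← ENNReal.rpow_inv_lt_iff hp]

/-- Rearranging the slices of a jointly measurable function gives a measurable function of the
parameter. -/
lemma measurable_rearr {α : Type*} [MeasurableSpace α] {F : α × ℝ → ℝ≥0∞} (hF : Measurable F)
    (t : ℝ) : Measurable fun a => rearr (fun s => F (a, s)) t := by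
  refine measurable_of_Ioi fun ρ => ?_
  have : (fun a => rearr (fun s => F (a, s)) t) ⁻¹' Set.Ioi ρ =
      (fun a => volume (Prod.mk a ⁻¹' {z | ρ < F z})) ⁻¹' Set.Ioi (ENNReal.ofReal t) := by
    ext a
    exact lt_rearr_iff
  rw [this]
  exact measurable_measure_prodMk_left (measurableSet_lt measurable_const hF) measurableSet_Ioi

lemma measurable_snoc (d : ℕ) :
    Measurable fun z : ℝ × (Fin d → ℝ) =>
      (Fin.snoc (α := fun _ => ℝ) z.2 z.1 : Fin (d + 1) → ℝ) := by
  refine measurable_pi_lambda _ fun i => ?_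
  refine Fin.lastCases ?_ (fun i => ?_) i
  · simpa using measurable_fst
  · simpa using (measurable_pi_apply (X := fun _ : Fin d => ℝ) i).fun_comp measurable_snd

lemma measurable_iterRearr {α : Type} [MeasurableSpace α] {d : ℕ} {F : α × (Fin d → ℝ) → ℝ≥0∞}
    (hF : Measurable F) (t : Fin d → ℝ) :
    Measurable fun a => iterRearr d (fun x => F (a, x)) t := by
  induction d generalizing α with
  | zero => exact hF.comp (measurable_id.prodMk measurable_const)
  | succ d ih =>
    have := ih (F := fun z : (α × ℝ) × (Fin d → ℝ) =>
      F (z.1.1, (Fin.snoc (α := fun _ => ℝ) z.2 z.1.2 : Fin (d + 1) → ℝ)))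
      (hF.comp (measurable_fst.fst.prodMk
        ((measurable_snoc d).comp (measurable_fst.snd.prodMk measurable_snd)))) (Fin.init t)
    exact measurable_rearr this (t (Fin.last d))

lemma measurable_iterRearr_snoc {d : ℕ} {F : (Fin (d + 1) → ℝ) → ℝ≥0∞} (hF : Measurable F)
    (t : Fin d → ℝ) :
    Measurable fun s : ℝ => iterRearr d (fun x => F (Fin.snoc (α := fun _ => ℝ) x s)) t :=
  measurable_iterRearr (α := ℝ) (F := fun z => F (Fin.snoc (α := fun _ => ℝ) z.2 z.1))
    (hF.comp (measurable_snoc d)) t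

/-- Splitting off the last coordinate preserves Lebesgue measure. -/
lemma measurePreserving_snoc (d : ℕ) :
    MeasurePreserving (fun z : ℝ × (Fin d → ℝ) =>
      (Fin.snoc (α := fun _ => ℝ) z.2 z.1 : Fin (d + 1) → ℝ)) (volume.prod volume) volume := by
  have := (volume_preserving_piFinSuccAbove (fun _ : Fin (d + 1) => ℝ) (Fin.last d)).symm
  have e : (fun z : ℝ × (Fin d → ℝ) => (Fin.snoc (α := fun _ => ℝ) z.2 z.1 : Fin (d + 1) → ℝ)) =
      (MeasurableEquiv.piFinSuccAbove (fun _ : Fin (d + 1) => ℝ) (Fin.last d)).symm := by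
    funext z
    change _ = Fin.insertNth (α := fun _ => ℝ) (Fin.last d) z.1 z.2
    rw [Fin.insertNth_last']
  rw [e]
  exact this

lemma lintegral_snoc {d : ℕ} {F : (Fin (d + 1) → ℝ) → ℝ≥0∞} (hF : Measurable F) :
    ∫⁻ x, F x = ∫⁻ s : ℝ, ∫⁻ x : Fin d → ℝ, F (Fin.snoc (α := fun _ => ℝ) x s) := by
  have h := measurePreserving_snoc d
  rw [← h.lintegral_comp hF]
  exact lintegral_prod _ (hF.comp h.measurable).aemeasurable

lemma iterRearr_congr_ae {d : ℕ} {F G : (Fin d → ℝ) → ℝ≥0∞} (h : F =ᵐ[volume] G)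
    (t : Fin d → ℝ) : iterRearr d F t = iterRearr d G t := by
  induction d with
  | zero =>
    rw [Filter.EventuallyEq, volume_pi, Measure.pi_of_empty, ae_dirac_eq] at h
    exact (congrArg F (Subsingleton.elim _ _)).trans
      (Filter.eventually_pure.1 h |>.trans (congrArg G (Subsingleton.elim _ _)))
  | succ d ih =>
    refine rearr_congr_ae ?_ _
    have h1 := (measurePreserving_snoc d).quasiMeasurePreserving.ae h
    filter_upwards [Measure.ae_ae_of_ae_prod h1] with s hs
    exact ih hs _

lemma iterRearr_antitone {d : ℕ} (F : (Fin d → ℝ) → ℝ≥0∞) : Antitone (iterRearr d F) := by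
  induction d with
  | zero => exact fun s t _ => (congrArg F (Subsingleton.elim _ _)).le
  | succ d ih =>
    intro s t hst
    refine (rearr_antitone _ (hst (Fin.last d))).trans (rearr_mono (ae_of_all _ fun x => ?_) _)
    exact ih _ fun i => hst i.castSucc

lemma iterRearr_rpow {d : ℕ} (F : (Fin d → ℝ) → ℝ≥0∞) {p : ℝ} (hp : 0 < p) (t : Fin d → ℝ) :
    iterRearr d (fun x => F x ^ p) t = iterRearr d F t ^ p := by
  induction d with
  | zero => rfl
  | succ d ih =>
    simp only [iterRearr]
    rw [← rearr_rpow _ hp]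
    congr 1
    ext s
    exact ih _ _

/-! ### A dyadic Hardy–Littlewood inequality -/

lemma ENNReal.two_rpow_add (x y : ℝ) : (2 : ℝ≥0∞) ^ (x + y) = 2 ^ x * 2 ^ y :=
  ENNReal.rpow_add x y two_ne_zero ENNReal.ofNat_ne_top

lemma ENNReal.two_rpow_ne_zero (x : ℝ) : (2 : ℝ≥0∞) ^ x ≠ 0 :=
  (ENNReal.rpow_pos two_pos ENNReal.ofNat_ne_top).ne'

lemma ENNReal.two_rpow_ne_top (x : ℝ) : (2 : ℝ≥0∞) ^ x ≠ ∞ :=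
  ENNReal.rpow_ne_top_of_ne_zero two_ne_zero ENNReal.ofNat_ne_top

lemma ENNReal.two_mul_two_rpow (x : ℝ) : (2 : ℝ≥0∞) * 2 ^ x = 2 ^ (x + 1) := by
  rw [ENNReal.two_rpow_add, ENNReal.rpow_one, mul_comm]

lemma ENNReal.ofReal_two_zpow (n : ℤ) : ENNReal.ofReal ((2 : ℝ) ^ n) = 2 ^ (n : ℝ) := by
  rw [← Real.rpow_intCast, ← ENNReal.ofReal_rpow_of_pos two_pos, ENNReal.ofReal_ofNat]

lemma ENNReal.tsum_snoc {β : Type*} {d : ℕ} (f : (Fin (d + 1) → β) → ℝ≥0∞) :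
    ∑' k, f k = ∑' b, ∑' k : Fin d → β, f (Fin.snoc (α := fun _ => β) k b) := by
  rw [← (Fin.snocEquiv fun _ : Fin (d + 1) => β).tsum_eq f, ENNReal.tsum_prod']
  rfl

lemma setLIntegral_le_tsum_rearr {g : ℝ → ℝ≥0∞} (hg : Measurable g) {E : Set ℝ}
    (hE : MeasurableSet E) (l : ℤ) (hl : volume E ≤ 2 * 2 ^ (l : ℝ)) :
    ∫⁻ x in E, g x ≤ 2 * ∑' i : ℕ, 2 ^ ((l : ℝ) - i) * rearr g (2 ^ (l - i : ℤ)) := by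
  -- `S 0 = E`, and `S (i + 1)` is the set where `g` exceeds `g^*(2^{l-i})`
  let S : ℕ → Set ℝ := fun i => Nat.casesOn i E fun i => {x | rearr g (2 ^ (l - i : ℤ)) < g x}
  have hSm : ∀ i, MeasurableSet (S i) := by
    rintro (_ | i)
    · exact hE
    · exact measurableSet_lt measurable_const hg
  have hSv : ∀ i, volume (S i) ≤ 2 * 2 ^ ((l : ℝ) - i) := by
    rintro (_ | i)
    · simpa [S] using hl
    · refine (volume_rearr_lt_le g _).trans ?_
      rw [ENNReal.ofReal_two_zpow, ENNReal.two_mul_two_rpow]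
      apply le_of_eq
      congr 1
      push_cast
      ring
  have hlim : Filter.Tendsto (fun i : ℕ => (2 : ℝ≥0∞) * 2 ^ ((l : ℝ) - (i + 1 : ℕ)))
      Filter.atTop (nhds 0) := by
    have h1 : ∀ i : ℕ, (2 : ℝ≥0∞) * 2 ^ ((l : ℝ) - (i + 1 : ℕ)) = 2 ^ (l : ℝ) * 2⁻¹ ^ i := by
      intro i
      rw [ENNReal.two_mul_two_rpow, ← ENNReal.rpow_natCast, ENNReal.inv_rpow, ← ENNReal.rpow_neg,
        ← ENNReal.two_rpow_add]
      congr 1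
      push_cast
      ring
    simp only [h1]
    have h2 := ENNReal.Tendsto.const_mul (a := (2 : ℝ≥0∞) ^ (l : ℝ))
      (ENNReal.tendsto_pow_atTop_nhds_zero_of_lt_one ENNReal.one_half_lt_one)
      (Or.inr (ENNReal.two_rpow_ne_top _))
    simpa using h2
  have hnull : ∀ᵐ x, ∃ i : ℕ, g x ≤ rearr g (2 ^ (l - i : ℤ)) := by
    rw [ae_iff]
    refine le_antisymm (ge_of_tendsto' hlim fun i => ?_) zero_le
    refine (measure_mono fun x hx => ?_).trans (hSv (i + 1))
    simp only [Set.mem_ofPred_eq, not_exists, not_le] at hx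
    exact hx i
  calc ∫⁻ x in E, g x
      = ∫⁻ x, E.indicator g x := (lintegral_indicator hE _).symm
    _ ≤ ∫⁻ x, ∑' i : ℕ, (S i).indicator (fun _ => rearr g (2 ^ (l - i : ℤ))) x := by
        refine lintegral_mono_ae ?_
        filter_upwards [hnull] with x hx
        by_cases hxE : x ∈ E
        · rw [Set.indicator_of_mem hxE]
          classical
          -- the least admissible `i` has `x ∈ S i`
          have hmem : x ∈ S (Nat.find hx) := by
            rcases h : Nat.find hx with _ | i
            · exact hxE
            · exact not_le.1 (Nat.find_min hx (m := i) (by omega))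
          refine le_trans ?_ (ENNReal.le_tsum (Nat.find hx))
          rw [Set.indicator_of_mem hmem]
          exact Nat.find_spec hx
        · rw [Set.indicator_of_notMem hxE]
          exact zero_le
    _ = ∑' i : ℕ, rearr g (2 ^ (l - i : ℤ)) * volume (S i) := by
        rw [lintegral_tsum fun i => (measurable_const.indicator (hSm i)).aemeasurable]
        congr 1
        ext i
        exact lintegral_indicator_const (hSm i) _
    _ ≤ 2 * ∑' i : ℕ, 2 ^ ((l : ℝ) - i) * rearr g (2 ^ (l - i : ℤ)) := by
        rw [← ENNReal.tsum_mul_left]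
        refine ENNReal.tsum_le_tsum fun i => ?_
        rw [← mul_assoc, mul_comm]
        gcongr
        exact hSv i

/-- The weight `min(1, 2 / (2^n |x|))`, a bound for the Fourier transform of the uniform
probability measure on an interval of length at least `2^n`. -/
noncomputable def decayWeight (n : ℤ) (x : ℝ) : ℝ≥0∞ := min 1 (2 / (2 ^ (n : ℝ) * ‖x‖ₑ))

lemma measurable_decayWeight (n : ℤ) : Measurable (decayWeight n) := by
  unfold decayWeight
  fun_prop

lemma decayWeight_le_tsum (n : ℤ) (x : ℝ) :
    decayWeight n x ≤ ∑' j : ℕ, 4 * 2 ^ (-(j : ℝ)) *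
      (Set.Icc (-(2 : ℝ) ^ (j - n : ℤ)) (2 ^ (j - n : ℤ))).indicator 1 x := by
  by_cases hx : |x| ≤ 2 ^ (-n)
  · refine le_trans ?_ (ENNReal.le_tsum 0)
    rw [Set.indicator_of_mem (by simpa [abs_le] using hx)]
    refine (min_le_left _ _).trans ?_
    simp only [CharP.cast_eq_zero, neg_zero, ENNReal.rpow_zero, Pi.one_apply, mul_one]
    norm_num
  · rw [not_le] at hx
    have hx0 : 0 < |x| := lt_trans (by positivity) hx
    obtain ⟨k, hk1, hk2⟩ := exists_mem_Ioc_zpow hx0 (one_lt_two (α := ℝ))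
    have hkn : -n < k + 1 := (zpow_lt_zpow_iff_right₀ one_lt_two).1 (hx.trans_le hk2)
    obtain ⟨j, hj⟩ := Int.eq_ofNat_of_zero_le (show 0 ≤ k + 1 + n by omega)
    refine le_trans ?_ (ENNReal.le_tsum j)
    rw [Set.indicator_of_mem (by
      rw [Set.mem_Icc, ← abs_le, show (j : ℤ) - n = k + 1 by omega]; exact hk2)]
    refine (min_le_right _ _).trans ?_
    have h1 : (2 : ℝ≥0∞) ^ (k : ℝ) ≤ ‖x‖ₑ := by
      rw [← ENNReal.ofReal_two_zpow, Real.enorm_eq_ofReal_abs]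
      exact ENNReal.ofReal_le_ofReal hk1.le
    have hjr : (j : ℝ) = k + 1 + n := by exact_mod_cast hj.symm
    calc (2 : ℝ≥0∞) / (2 ^ (n : ℝ) * ‖x‖ₑ) ≤ 2 / (2 ^ (n : ℝ) * 2 ^ (k : ℝ)) := by gcongr
      _ = 4 * 2 ^ (-(j : ℝ)) * 1 := by
          rw [← ENNReal.two_rpow_add, div_eq_mul_inv, ← ENNReal.rpow_neg, mul_one]
          rw [show (4 : ℝ≥0∞) = 2 * 2 by norm_num, mul_assoc,
            ENNReal.two_mul_two_rpow, ENNReal.two_mul_two_rpow, ENNReal.two_mul_two_rpow, hjr]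
          congr 1
          ring

lemma lintegral_mul_decayWeight_le {g : ℝ → ℝ≥0∞} (hg : Measurable g) (n : ℤ) :
    ∫⁻ x, g x * decayWeight n x ≤
      ∑' k : ℕ × ℕ, 8 * 2 ^ (-(n : ℝ) - k.2) * rearr g (2 ^ (k.1 - k.2 - n : ℤ)) := by
  let E : ℕ → Set ℝ := fun j => Set.Icc (-(2 : ℝ) ^ (j - n : ℤ)) (2 ^ (j - n : ℤ))
  have hE : ∀ j, MeasurableSet (E j) := fun j => measurableSet_Icc
  have hEv : ∀ j, volume (E j) ≤ 2 * 2 ^ ((j - n : ℤ) : ℝ) := by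
    intro j
    simp only [E]
    rw [Real.volume_Icc, sub_neg_eq_add, ← two_mul, ENNReal.ofReal_mul two_pos.le,
      ENNReal.ofReal_two_zpow, ENNReal.ofReal_ofNat]
  calc ∫⁻ x, g x * decayWeight n x
      ≤ ∫⁻ x, ∑' j : ℕ, 4 * 2 ^ (-(j : ℝ)) * (E j).indicator g x := by
        refine lintegral_mono fun x => ?_
        refine (mul_le_mul_right (decayWeight_le_tsum n x) (g x)).trans ?_
        rw [← ENNReal.tsum_mul_left]
        refine ENNReal.tsum_le_tsum fun j => le_of_eq ?_
        by_cases hx : x ∈ E j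
        · rw [Set.indicator_of_mem hx, Set.indicator_of_mem hx, Pi.one_apply, mul_one, mul_comm]
        · rw [Set.indicator_of_notMem hx, Set.indicator_of_notMem hx]
          simp
    _ = ∑' j : ℕ, 4 * 2 ^ (-(j : ℝ)) * ∫⁻ x in E j, g x := by
        rw [lintegral_tsum fun j => ((hg.indicator (hE j)).const_mul _).aemeasurable]
        congr 1
        ext j
        rw [lintegral_const_mul _ (hg.indicator (hE j)), lintegral_indicator (hE j)]
    _ ≤ ∑' j : ℕ, ∑' i : ℕ, 8 * 2 ^ (-(n : ℝ) - i) * rearr g (2 ^ (j - i - n : ℤ)) := by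
        refine ENNReal.tsum_le_tsum fun j => ?_
        refine (mul_le_mul_right (setLIntegral_le_tsum_rearr hg (hE j) _ (hEv j)) _).trans ?_
        rw [← ENNReal.tsum_mul_left, ← ENNReal.tsum_mul_left]
        refine ENNReal.tsum_le_tsum fun i => le_of_eq ?_
        rw [show ((j : ℤ) - n - i) = j - i - n by ring,
          show -(n : ℝ) - i = -j + (((j - n : ℤ) : ℝ) - i) by push_cast; ring,
          ENNReal.two_rpow_add (-(j : ℝ)), show (8 : ℝ≥0∞) = 4 * 2 by norm_num]
        ring
    _ = _ := (ENNReal.tsum_prod' (f := fun k : ℕ × ℕ =>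
        8 * 2 ^ (-(n : ℝ) - k.2) * rearr g (2 ^ (k.1 - k.2 - n : ℤ)))).symm

/-- The Hardy–Littlewood inequality for the iterated rearrangement against a product of decaying
weights, in dyadic form. -/
lemma lintegral_mul_prod_decayWeight_le {d : ℕ} {F : (Fin d → ℝ) → ℝ≥0∞} (hF : Measurable F)
    (n : Fin d → ℤ) :
    ∫⁻ x, F x * ∏ i, decayWeight (n i) (x i) ≤
      ∑' k : Fin d → ℕ × ℕ, (∏ i, 8 * 2 ^ (-(n i : ℝ) - (k i).2)) *
        iterRearr d F fun i => 2 ^ ((k i).1 - (k i).2 - n i : ℤ) := by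
  induction d with
  | zero =>
    rw [tsum_eq_single default fun k hk => (hk (Subsingleton.elim _ _)).elim]
    simp only [Finset.univ_eq_empty, Finset.prod_empty, mul_one, one_mul, iterRearr]
    rw [volume_pi, Measure.pi_of_empty, lintegral_dirac]
    exact (congrArg F (Subsingleton.elim _ _)).le
  | succ d ih =>
    have hW : Measurable fun x : Fin (d + 1) → ℝ => F x * ∏ i, decayWeight (n i) (x i) := by
      refine hF.mul (Finset.measurable_prod _ fun i _ => ?_)
      exact (measurable_decayWeight _).comp (measurable_pi_apply i)
    rw [lintegral_snoc hW, ENNReal.tsum_snoc, ENNReal.tsum_comm]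
    let c : (Fin d → ℕ × ℕ) → ℝ≥0∞ := fun k => ∏ i, 8 * 2 ^ (-(n i.castSucc : ℝ) - (k i).2)
    let G : (Fin d → ℕ × ℕ) → ℝ → ℝ≥0∞ := fun k s =>
      iterRearr d (fun x => F (Fin.snoc (α := fun _ => ℝ) x s)) fun i =>
        2 ^ ((k i).1 - (k i).2 - n i.castSucc : ℤ)
    have hG : ∀ k, Measurable (G k) := fun k => measurable_iterRearr_snoc hF _
    calc ∫⁻ s : ℝ, ∫⁻ x : Fin d → ℝ, F (Fin.snoc (α := fun _ => ℝ) x s) *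
          ∏ i, decayWeight (n i) ((Fin.snoc (α := fun _ => ℝ) x s : Fin (d + 1) → ℝ) i)
        = ∫⁻ s : ℝ, (∫⁻ x : Fin d → ℝ, F (Fin.snoc (α := fun _ => ℝ) x s) *
          ∏ i : Fin d, decayWeight (n i.castSucc) (x i)) * decayWeight (n (Fin.last d)) s := by
          refine lintegral_congr fun s => ?_
          rw [← lintegral_mul_const]
          · refine lintegral_congr fun x => ?_
            simp only [Fin.prod_univ_castSucc, Fin.snoc_castSucc, Fin.snoc_last, mul_assoc]
          · refine (hF.comp ((measurable_snoc d).comp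
              (measurable_const.prodMk measurable_id))).mul
              (Finset.measurable_prod _ fun i _ => ?_)
            exact (measurable_decayWeight _).comp (measurable_pi_apply i)
      _ ≤ ∫⁻ s : ℝ, ∑' k : Fin d → ℕ × ℕ, c k * (G k s * decayWeight (n (Fin.last d)) s) := by
          refine lintegral_mono fun s => ?_
          simp only [← mul_assoc]
          rw [ENNReal.tsum_mul_right]
          gcongr
          exact ih (hF.comp ((measurable_snoc d).comp (measurable_const.prodMk measurable_id)))
            (fun i => n i.castSucc)
      _ = ∑' k : Fin d → ℕ × ℕ, c k * ∫⁻ s : ℝ, G k s * decayWeight (n (Fin.last d)) s := by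
          have hm : ∀ k, Measurable fun s => G k s * decayWeight (n (Fin.last d)) s :=
            fun k => (hG k).mul (measurable_decayWeight _)
          rw [lintegral_tsum fun k => ((hm k).const_mul _).aemeasurable]
          simp only [lintegral_const_mul _ (hm _)]
      _ ≤ _ := by
          refine ENNReal.tsum_le_tsum fun k => ?_
          refine (mul_le_mul_right (lintegral_mul_decayWeight_le (hG k) _) _).trans ?_
          rw [← ENNReal.tsum_mul_left]
          refine ENNReal.tsum_le_tsum fun b => le_of_eq ?_
          rw [Fin.prod_univ_castSucc, ← mul_assoc]
          simp only [Fin.snoc_castSucc, Fin.snoc_last, iterRearr, c, G, Fin.init_def]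

/-! ### The convolution estimate -/

/-- The value of `powerWeight p` at the dyadic point `(2^{n_1}, …, 2^{n_d})`. -/
noncomputable def dyadicPowerWeight {d : ℕ} (p : Fin d → ℝ) (n : Fin d → ℤ) : ℝ≥0∞ :=
  ∏ i, 2 ^ ((n i : ℝ) * (1 / p i))

lemma powerWeight_two_zpow {d : ℕ} (p : Fin d → ℝ) (n : Fin d → ℤ) :
    powerWeight p (fun i => 2 ^ n i) = dyadicPowerWeight p n := by
  simp only [powerWeight, dyadicPowerWeight, ENNReal.ofReal_two_zpow, ← ENNReal.rpow_mul]

lemma ENNReal.tsum_prod_pi {β : Type*} {d : ℕ} (f : Fin d → β → ℝ≥0∞) :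
    ∑' k : Fin d → β, ∏ i, f i (k i) = ∏ i, ∑' b, f i b := by
  induction d with
  | zero => rw [tsum_eq_single default fun k hk => (hk (Subsingleton.elim _ _)).elim]; simp
  | succ d ih =>
    rw [ENNReal.tsum_snoc, Fin.prod_univ_castSucc, ← ih fun i => f i.castSucc, mul_comm,
      ← ENNReal.tsum_mul_right]
    congr 1
    ext b
    rw [← ENNReal.tsum_mul_left]
    simp only [Fin.prod_univ_castSucc, Fin.snoc_castSucc, Fin.snoc_last, mul_comm]

lemma ENNReal.tsum_two_rpow_neg_ne_top {a : ℝ} (ha : 0 < a) :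
    ∑' j : ℕ, (2 : ℝ≥0∞) ^ (-((j : ℝ) * a)) ≠ ∞ := by
  have h1 : ∀ j : ℕ, (2 : ℝ≥0∞) ^ (-((j : ℝ) * a)) = (2 ^ (-a)) ^ j := by
    intro j
    rw [← ENNReal.rpow_natCast, ← ENNReal.rpow_mul]
    congr 1
    ring
  have h2 : (2 : ℝ≥0∞) ^ (-a) < 1 :=
    ENNReal.rpow_lt_one_of_one_lt_of_neg ENNReal.one_lt_two (neg_lt_zero.2 ha)
  simp only [h1, ENNReal.tsum_geometric]
  exact ENNReal.inv_ne_top.2 (tsub_pos_of_lt h2).ne'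

/-- The coefficients of the convolution dominating the weighted integrals are summable to every
positive power. -/
lemma tsum_convolution_coeff_ne_top {a b r : ℝ} (ha : 0 < a) (hb : 0 < b) (hr : 0 < r) :
    ∑' k : ℕ × ℕ, ((8 : ℝ≥0∞) * 2 ^ (-(k.1 * a) - k.2 * b)) ^ r ≠ ∞ := by
  have h1 : ∀ k : ℕ × ℕ, ((8 : ℝ≥0∞) * 2 ^ (-(k.1 * a) - k.2 * b)) ^ r =
      8 ^ r * (2 ^ (-((k.1 : ℝ) * (a * r))) * 2 ^ (-((k.2 : ℝ) * (b * r)))) := by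
    intro k
    rw [ENNReal.mul_rpow_of_nonneg _ _ hr.le, ← ENNReal.rpow_mul, ← ENNReal.two_rpow_add]
    congr 2
    ring
  simp only [h1, ENNReal.tsum_mul_left]
  rw [ENNReal.tsum_prod' (f := fun k : ℕ × ℕ =>
    (2 : ℝ≥0∞) ^ (-((k.1 : ℝ) * (a * r))) * 2 ^ (-((k.2 : ℝ) * (b * r))))]
  simp only [ENNReal.tsum_mul_left, ENNReal.tsum_mul_right]
  exact ENNReal.mul_ne_top (ENNReal.rpow_ne_top_of_nonneg hr.le (by norm_num))
    (ENNReal.mul_ne_top (ENNReal.tsum_two_rpow_neg_ne_top (mul_pos ha hr))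
      (ENNReal.tsum_two_rpow_neg_ne_top (mul_pos hb hr)))

lemma exists_exponent_le {d : ℕ} {q : Fin d → ℝ≥0∞} (hq : ∀ i, 0 < q i) :
    ∃ r : ℝ, 0 < r ∧ r ≤ 1 ∧ ∀ i, ENNReal.ofReal r ≤ q i := by
  set ρ : ℝ≥0∞ := min 1 (Finset.univ.inf q) with hρ
  have h0 : 0 < ρ :=
    lt_min one_pos ((Finset.lt_inf_iff ENNReal.zero_lt_top).2 fun i _ => hq i)
  have h1 : ρ ≤ 1 := min_le_left _ _
  have ht : ρ ≠ ∞ := ne_top_of_le_ne_top ENNReal.one_ne_top h1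
  refine ⟨ρ.toReal, ENNReal.toReal_pos h0.ne' ht, ENNReal.toReal_le_of_le_ofReal one_pos.le
    (by simpa using h1), fun i => ?_⟩
  rw [ENNReal.ofReal_toReal ht]
  exact (min_le_right _ _).trans (Finset.inf_le (Finset.mem_univ i))

/-- A Hardy inequality in the iterated norm: the weighted integrals are dominated by a convolution
of the dyadic values of the rearrangement with geometrically decaying coefficients. -/
lemma dyadicNorm_lintegral_decayWeight_le {d : ℕ} {p : Fin d → ℝ} {q : Fin d → ℝ≥0∞}
    (hp : ∀ i, 1 < p i) (hq : ∀ i, 0 < q i) :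
    ∃ C : ℝ≥0, ∀ F : (Fin d → ℝ) → ℝ≥0∞, Measurable F →
      dyadicNorm d q (fun n => dyadicPowerWeight (fun i => p i / (p i - 1)) n *
          ∫⁻ x, F x * ∏ i, decayWeight (n i) (x i)) ≤
        C * dyadicNorm d q fun n => dyadicPowerWeight p n * iterRearr d F fun i => 2 ^ n i := by
  obtain ⟨r, hr, hr1, hrq⟩ := exists_exponent_le hq
  let c : Fin d → ℕ × ℕ → ℝ≥0∞ := fun i k =>
    8 * 2 ^ (-(k.1 * (1 / p i)) - k.2 * (1 - 1 / p i))
  let S : ℝ≥0∞ := ∑' k : Fin d → ℕ × ℕ, (∏ i, c i (k i)) ^ r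
  have hS : S ≠ ∞ := by
    simp only [S, ← ENNReal.prod_rpow_of_nonneg hr.le, ENNReal.tsum_prod_pi fun i k => c i k ^ r]
    refine ENNReal.prod_ne_top fun i _ => tsum_convolution_coeff_ne_top ?_ ?_ hr
    · have := hp i; positivity
    · have := hp i
      rw [sub_pos, div_lt_one (by linarith)]
      exact this
  refine ⟨(S ^ r⁻¹).toNNReal, fun F hF => ?_⟩
  rw [ENNReal.coe_toNNReal (ENNReal.rpow_ne_top_of_nonneg (by positivity) hS)]
  set b : (Fin d → ℤ) → ℝ≥0∞ := fun n => dyadicPowerWeight p n * iterRearr d F fun i => 2 ^ n i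
    with hb
  have hpt : ∀ n : Fin d → ℤ, dyadicPowerWeight (fun i => p i / (p i - 1)) n *
      ∫⁻ x, F x * ∏ i, decayWeight (n i) (x i) ≤
      ∑' k : Fin d → ℕ × ℕ, (∏ i, c i (k i)) * b fun i => (k i).1 - (k i).2 - n i := by
    intro n
    refine (mul_le_mul_right (lintegral_mul_prod_decayWeight_le hF n) _).trans ?_
    rw [← ENNReal.tsum_mul_left]
    refine ENNReal.tsum_le_tsum fun k => le_of_eq ?_
    rw [hb, ← mul_assoc, ← mul_assoc]
    congr 1
    simp only [dyadicPowerWeight, c, ← Finset.prod_mul_distrib]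
    refine Finset.prod_congr rfl fun i _ => ?_
    -- with `k = (j, l)`: `n/p' - n - l = -j/p - l/p' + (j - l - n)/p`
    have h0 : p i ≠ 0 := by linarith [hp i]
    have h1 : p i - 1 ≠ 0 := by linarith [hp i]
    rw [mul_left_comm, mul_assoc, ← ENNReal.two_rpow_add, ← ENNReal.two_rpow_add]
    congr 2
    push_cast
    field_simp
    ring
  have hD : ∀ k : Fin d → ℕ × ℕ, dyadicNorm d q (fun n => (∏ i, c i (k i)) *
      b fun i => (k i).1 - (k i).2 - n i) = (∏ i, c i (k i)) * dyadicNorm d q b := by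
    intro k
    rw [dyadicNorm_const_mul hq]
    congr 1
    exact dyadicNorm_comp_equiv q (fun i => Equiv.subLeft ((k i).1 - (k i).2 : ℤ)) b
  refine (dyadicNorm_mono hpt).trans ?_
  rw [← ENNReal.rpow_le_rpow_iff hr]
  refine (dyadicNorm_tsum_rpow_le hr hr1 hrq _).trans (le_of_eq ?_)
  simp only [hD, ENNReal.mul_rpow_of_nonneg _ _ hr.le, ENNReal.tsum_mul_right]
  rw [ENNReal.rpow_inv_rpow hr.ne']

/-! ### Averages of the truncated Fourier transform -/

lemma norm_exp_neg_I_mul (s : ℝ) : ‖Complex.exp (-Complex.I * (s : ℂ))‖ = 1 := by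
  rw [neg_mul, ← mul_neg, mul_comm, ← Complex.ofReal_neg]
  exact Complex.norm_exp_ofReal_mul_I _

lemma norm_setIntegral_exp_le {a b : ℝ} (hab : a ≤ b) (x : ℝ) :
    ‖∫ ξ in Set.Icc a b, Complex.exp (-Complex.I * ((ξ * x : ℝ) : ℂ))‖ ≤ b - a := by
  have := norm_setIntegral_le_of_norm_le_const (μ := volume) (s := Set.Icc a b)
    (f := fun ξ : ℝ => Complex.exp (-Complex.I * ((ξ * x : ℝ) : ℂ))) (C := 1)
    measure_Icc_lt_top (fun ξ _ => (norm_exp_neg_I_mul _).le)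
  simpa [hab] using this

lemma norm_setIntegral_exp_mul_abs_le {a b : ℝ} (hab : a ≤ b) (x : ℝ) :
    ‖∫ ξ in Set.Icc a b, Complex.exp (-Complex.I * ((ξ * x : ℝ) : ℂ))‖ * |x| ≤ 2 := by
  rcases eq_or_ne x 0 with rfl | hx
  · simp
  have hc : -Complex.I * (x : ℂ) ≠ 0 := by simp [hx]
  have h1 : ∀ ξ : ℝ, -Complex.I * ((ξ * x : ℝ) : ℂ) = -Complex.I * (x : ℂ) * (ξ : ℂ) := by
    intro ξ
    push_cast
    ring
  have h2 : ‖-Complex.I * (x : ℂ)‖ = |x| := by simp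
  have h3 : ∀ ξ : ℝ, ‖Complex.exp (-Complex.I * (x : ℂ) * (ξ : ℂ))‖ = 1 := fun ξ => by
    rw [← h1, norm_exp_neg_I_mul]
  rw [integral_Icc_eq_integral_Ioc, ← intervalIntegral.integral_of_le hab]
  simp only [h1]
  rw [integral_exp_mul_complex hc, norm_div, h2, div_mul_cancel₀ _ (abs_ne_zero.2 hx)]
  refine (norm_sub_le _ _).trans ?_
  rw [h3, h3]
  norm_num

lemma enorm_average_exp_le_decayWeight {a b : ℝ} {n : ℤ} (hab : a < b)
    (hn : (2 : ℝ) ^ n ≤ b - a) (x : ℝ) :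
    ENNReal.ofReal (b - a)⁻¹ *
      ‖∫ ξ in Set.Icc a b, Complex.exp (-Complex.I * ((ξ * x : ℝ) : ℂ))‖ₑ ≤ decayWeight n x := by
  set J := ∫ ξ in Set.Icc a b, Complex.exp (-Complex.I * ((ξ * x : ℝ) : ℂ)) with hJ
  have hba : 0 < b - a := sub_pos.2 hab
  refine le_min ?_ ?_
  · rw [← ofReal_norm, ← ENNReal.ofReal_mul (by positivity), ← ENNReal.ofReal_one]
    refine ENNReal.ofReal_le_ofReal ?_
    rw [inv_mul_le_iff₀ hba, mul_one]
    exact norm_setIntegral_exp_le hab.le x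
  · rw [ENNReal.le_div_iff_mul_le (Or.inr two_ne_zero) (Or.inr ENNReal.ofNat_ne_top),
      ← ENNReal.ofReal_two_zpow, ← ofReal_norm, ← ofReal_norm,
      ← ENNReal.ofReal_mul (by positivity), ← ENNReal.ofReal_mul (by positivity),
      ← ENNReal.ofReal_mul (by positivity), ← ENNReal.ofReal_ofNat 2]
    refine ENNReal.ofReal_le_ofReal ?_
    calc (b - a)⁻¹ * ‖J‖ * (2 ^ n * ‖x‖) = ((b - a)⁻¹ * 2 ^ n) * (‖J‖ * |x|) := by
          rw [Real.norm_eq_abs]; ring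
      _ ≤ 1 * 2 := by
          gcongr
          · rw [inv_mul_le_iff₀ hba, mul_one]
            exact hn
          · exact norm_setIntegral_exp_mul_abs_le hab.le x
      _ = 2 := one_mul 2

/-- By Fubini's theorem, the integral of the truncated Fourier transform over a rectangle. -/
lemma setIntegral_truncFourier {d : ℕ} {N : ℝ} {f : (Fin d → ℝ) → ℂ}
    (hf : IntegrableOn f (centredCube d N) volume) (a b : Fin d → ℝ) :
    ∫ ξ in Set.Icc a b, truncFourier N f ξ = ∫ x in centredCube d N, f x *
      ∏ i, ∫ ξ in Set.Icc (a i) (b i), Complex.exp (-Complex.I * ((ξ * x i : ℝ) : ℂ)) := by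
  have hfin : IsFiniteMeasure (volume.restrict (Set.Icc a b)) :=
    isFiniteMeasure_restrict.2 (isCompact_Icc.measure_lt_top).ne
  have hint : Integrable (Function.uncurry fun ξ x : Fin d → ℝ =>
      f x * Complex.exp (-Complex.I * ((∑ i, ξ i * x i : ℝ) : ℂ)))
      ((volume.restrict (Set.Icc a b)).prod (volume.restrict (centredCube d N))) := by
    refine (Integrable.comp_snd hf _).mul_bdd (c := 1) ?_
      (ae_of_all _ fun z => (norm_exp_neg_I_mul _).le)
    exact Continuous.aestronglyMeasurable (by fun_prop)
  unfold truncFourier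
  rw [integral_integral_swap hint]
  congr 1
  ext x
  rw [integral_const_mul]
  congr 1
  rw [← Set.pi_univ_Icc, volume_pi, Measure.restrict_pi_pi, ← integral_fintype_prod_eq_prod]
  congr 1
  ext ξ
  rw [← Complex.exp_sum, Complex.ofReal_sum, Finset.mul_sum]

lemma continuous_truncFourier {d : ℕ} {N : ℝ} {f : (Fin d → ℝ) → ℂ}
    (hf : IntegrableOn f (centredCube d N) volume) : Continuous (truncFourier N f) := by
  refine continuous_of_dominated (bound := fun x => ‖f x‖) (fun ξ => ?_)
    (fun ξ => ae_of_all _ fun x => ?_) hf.norm (ae_of_all _ fun x => by fun_prop)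
  · exact hf.1.mul (Continuous.aestronglyMeasurable (by fun_prop))
  · rw [norm_mul, norm_exp_neg_I_mul, mul_one]

lemma netAverage_truncFourier_le {d : ℕ} {N : ℝ} {f : (Fin d → ℝ) → ℂ}
    (hf : IntegrableOn f (centredCube d N) volume) (n : Fin d → ℤ) :
    netAverage (truncFourier N f) (fun i => 2 ^ n i) ≤
      ∫⁻ x, ‖f x‖ₑ * ∏ i, decayWeight (n i) (x i) := by
  refine iSup_le fun a => iSup_le fun b => iSup_le fun hab => ?_
  have hpos : ∀ i, 0 ≤ (b i - a i)⁻¹ := fun i => inv_nonneg.2 (sub_pos.2 (hab i).1).le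
  rw [setIntegral_truncFourier hf, ← Finset.prod_inv_distrib,
    ENNReal.ofReal_mul (Finset.prod_nonneg fun i _ => hpos i),
    ENNReal.ofReal_prod_of_nonneg fun i _ => hpos i, ofReal_norm]
  calc (∏ i, ENNReal.ofReal (b i - a i)⁻¹) * ‖∫ x in centredCube d N, f x *
        ∏ i, ∫ ξ in Set.Icc (a i) (b i), Complex.exp (-Complex.I * ((ξ * x i : ℝ) : ℂ))‖ₑ
      ≤ (∏ i, ENNReal.ofReal (b i - a i)⁻¹) * ∫⁻ x, ‖f x *
        ∏ i, ∫ ξ in Set.Icc (a i) (b i), Complex.exp (-Complex.I * ((ξ * x i : ℝ) : ℂ))‖ₑ := by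
        gcongr
        exact (enorm_integral_le_lintegral_enorm _).trans (setLIntegral_le_lintegral _ _)
    _ = ∫⁻ x, ‖f x‖ₑ * ∏ i, (ENNReal.ofReal (b i - a i)⁻¹ *
          ‖∫ ξ in Set.Icc (a i) (b i), Complex.exp (-Complex.I * ((ξ * x i : ℝ) : ℂ))‖ₑ) := by
        rw [← lintegral_const_mul' _ _ (ENNReal.prod_ne_top fun i _ => ENNReal.ofReal_ne_top)]
        refine lintegral_congr fun x => ?_
        rw [enorm_mul, Finset.prod_mul_distrib, mul_left_comm]
        congr 2
        simp only [enorm_eq_nnnorm, nnnorm_prod, ENNReal.ofNNReal_finsetProd]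
    _ ≤ ∫⁻ x, ‖f x‖ₑ * ∏ i, decayWeight (n i) (x i) := by
        gcongr with x i
        exact enorm_average_exp_le_decayWeight (hab i).1 (hab i).2 _

lemma netAverage_antitone {d : ℕ} (f : (Fin d → ℝ) → ℂ) : Antitone (netAverage f) :=
  fun _ _ hst => iSup_mono fun _ => iSup_mono fun _ => iSup_mono' fun h =>
    ⟨fun i => ⟨(h i).1, (hst i).trans (h i).2⟩, le_rfl⟩

/-! ### Dyadic sums of rearrangements -/

lemma lintegral_Ioi_indicator_lt (c : ℝ≥0∞) :
    ∫⁻ ρ in Set.Ioi (0 : ℝ), {ρ : ℝ | ENNReal.ofReal ρ < c}.indicator 1 ρ = c := by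
  rw [lintegral_indicator_one (measurableSet_lt ENNReal.measurable_ofReal measurable_const),
    Measure.restrict_apply (measurableSet_lt ENNReal.measurable_ofReal measurable_const)]
  rcases eq_or_ne c ∞ with rfl | hc
  · simp
  · have : {ρ : ℝ | ENNReal.ofReal ρ < c} ∩ Set.Ioi 0 = Set.Ioo 0 c.toReal := by
      ext ρ
      simp only [Set.mem_inter_iff, Set.mem_ofPred_eq, Set.mem_Ioi, Set.mem_Ioo, and_comm]
      refine and_congr_left fun hρ => ?_
      rw [ENNReal.ofReal_lt_iff_lt_toReal hρ.le hc]
    rw [this, Real.volume_Ioo, sub_zero, ENNReal.ofReal_toReal hc]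

lemma tsum_two_rpow_indicator_le (v : ℝ≥0∞) :
    ∑' n : ℤ, (2 : ℝ≥0∞) ^ (n : ℝ) * {n : ℤ | (2 : ℝ≥0∞) ^ (n : ℝ) < v}.indicator 1 n ≤ 2 * v := by
  rw [← lintegral_Ioi_indicator_lt (2 * v), lintegral_Ioi_eq_tsum_dyadic]
  refine ENNReal.tsum_le_tsum fun n => ?_
  by_cases hn : n ∈ {n : ℤ | (2 : ℝ≥0∞) ^ (n : ℝ) < v}
  · rw [Set.indicator_of_mem hn, Pi.one_apply, mul_one, ← ENNReal.ofReal_two_zpow,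
      ← volume_Ico_two_zpow, ← setLIntegral_one]
    refine setLIntegral_mono' measurableSet_Ico fun s hs => ?_
    rw [Set.indicator_of_mem, Pi.one_apply]
    have h1 : ENNReal.ofReal s < 2 * 2 ^ (n : ℝ) := by
      rw [← ENNReal.ofReal_two_zpow, ← ENNReal.ofReal_ofNat 2, ← ENNReal.ofReal_mul two_pos.le]
      refine (ENNReal.ofReal_lt_ofReal_iff (by positivity)).2 ?_
      rw [mul_comm, ← zpow_add_one₀ two_ne_zero]
      exact hs.2
    exact h1.trans_le (mul_le_mul_right (le_of_lt hn) 2)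
  · rw [Set.indicator_of_notMem hn, mul_zero]
    exact zero_le

lemma tsum_rearr_le_lintegral {g : ℝ → ℝ≥0∞} (hg : Measurable g) :
    ∑' n : ℤ, (2 : ℝ≥0∞) ^ (n : ℝ) * rearr g (2 ^ n) ≤ 2 * ∫⁻ x, g x := by
  let V : ℝ → ℝ≥0∞ := fun ρ => volume {x | ENNReal.ofReal ρ < g x}
  have hset : MeasurableSet {z : ℝ × ℝ | ENNReal.ofReal z.1 < g z.2} :=
    measurableSet_lt (ENNReal.measurable_ofReal.comp measurable_fst) (hg.comp measurable_snd)
  have hV : Measurable V := measurable_measure_prodMk_left hset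
  -- the layer cake formula
  have hcake : ∫⁻ x, g x = ∫⁻ ρ in Set.Ioi (0 : ℝ), V ρ := by
    calc ∫⁻ x, g x = ∫⁻ x, ∫⁻ ρ in Set.Ioi (0 : ℝ),
          {z : ℝ × ℝ | ENNReal.ofReal z.1 < g z.2}.indicator 1 (ρ, x) :=
          lintegral_congr fun x => (lintegral_Ioi_indicator_lt (g x)).symm
      _ = ∫⁻ ρ in Set.Ioi (0 : ℝ), ∫⁻ x,
          {z : ℝ × ℝ | ENNReal.ofReal z.1 < g z.2}.indicator 1 (ρ, x) :=
          lintegral_lintegral_swap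
            (((measurable_one.indicator hset).comp measurable_swap).aemeasurable)
      _ = ∫⁻ ρ in Set.Ioi (0 : ℝ), V ρ := by
          refine lintegral_congr fun ρ => ?_
          exact lintegral_indicator_one
            (measurableSet_lt (measurable_const (a := ENNReal.ofReal ρ)) hg)
  have hterm : ∀ n : ℤ, rearr g (2 ^ n) = ∫⁻ ρ in Set.Ioi (0 : ℝ),
      {n : ℤ | (2 : ℝ≥0∞) ^ (n : ℝ) < V ρ}.indicator 1 n := by
    intro n
    rw [← lintegral_Ioi_indicator_lt (rearr g (2 ^ n))]
    refine lintegral_congr fun ρ => ?_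
    simp only [Set.indicator_apply, Set.mem_ofPred_eq, lt_rearr_iff, ENNReal.ofReal_two_zpow,
      Pi.one_apply, V]
  have hmeas : ∀ n : ℤ, Measurable fun ρ =>
      {n : ℤ | (2 : ℝ≥0∞) ^ (n : ℝ) < V ρ}.indicator (1 : ℤ → ℝ≥0∞) n := fun n =>
    (measurable_one (α := ℝ≥0∞)).indicator (measurableSet_lt measurable_const hV)
  calc ∑' n : ℤ, (2 : ℝ≥0∞) ^ (n : ℝ) * rearr g (2 ^ n)
      = ∫⁻ ρ in Set.Ioi (0 : ℝ), ∑' n : ℤ, (2 : ℝ≥0∞) ^ (n : ℝ) *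
          {n : ℤ | (2 : ℝ≥0∞) ^ (n : ℝ) < V ρ}.indicator 1 n := by
        rw [lintegral_tsum fun n => ((hmeas n).const_mul _).aemeasurable]
        simp only [lintegral_const_mul _ (hmeas _), ← hterm]
    _ ≤ ∫⁻ ρ in Set.Ioi (0 : ℝ), 2 * V ρ := lintegral_mono fun ρ => tsum_two_rpow_indicator_le _
    _ = 2 * ∫⁻ x, g x := by rw [lintegral_const_mul _ hV, hcake]

lemma tsum_iterRearr_le_lintegral {d : ℕ} {F : (Fin d → ℝ) → ℝ≥0∞} (hF : Measurable F) :
    ∑' n : Fin d → ℤ, (∏ i, (2 : ℝ≥0∞) ^ (n i : ℝ)) * iterRearr d F (fun i => 2 ^ n i) ≤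
      2 ^ d * ∫⁻ x, F x := by
  induction d with
  | zero =>
    rw [tsum_eq_single default fun k hk => (hk (Subsingleton.elim _ _)).elim]
    simp only [Finset.univ_eq_empty, Finset.prod_empty, one_mul, iterRearr, pow_zero]
    rw [volume_pi, Measure.pi_of_empty, lintegral_dirac]
    exact (congrArg F (Subsingleton.elim _ _)).le
  | succ d ih =>
    let G : (Fin d → ℤ) → ℝ → ℝ≥0∞ := fun k s =>
      iterRearr d (fun x => F (Fin.snoc (α := fun _ => ℝ) x s)) fun i => 2 ^ k i
    have hG : ∀ k, Measurable (G k) := fun k => measurable_iterRearr_snoc hF _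
    rw [lintegral_snoc hF, ENNReal.tsum_snoc, ENNReal.tsum_comm]
    calc ∑' k : Fin d → ℤ, ∑' m : ℤ,
          (∏ i, (2 : ℝ≥0∞) ^ (((Fin.snoc (α := fun _ => ℤ) k m : Fin (d + 1) → ℤ) i : ℤ) : ℝ)) *
            iterRearr (d + 1) F
              (fun i => 2 ^ ((Fin.snoc (α := fun _ => ℤ) k m : Fin (d + 1) → ℤ) i))
        = ∑' k : Fin d → ℤ, (∏ i, (2 : ℝ≥0∞) ^ (k i : ℝ)) *
            ∑' m : ℤ, (2 : ℝ≥0∞) ^ (m : ℝ) * rearr (G k) (2 ^ m) := by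
          simp only [← ENNReal.tsum_mul_left, ← mul_assoc]
          simp only [Fin.prod_univ_castSucc, Fin.snoc_castSucc, Fin.snoc_last, iterRearr, G,
            Fin.init_def]
      _ ≤ ∑' k : Fin d → ℤ, (∏ i, (2 : ℝ≥0∞) ^ (k i : ℝ)) * (2 * ∫⁻ s, G k s) := by
          gcongr with k
          exact tsum_rearr_le_lintegral (hG k)
      _ = 2 * ∫⁻ s, ∑' k : Fin d → ℤ, (∏ i, (2 : ℝ≥0∞) ^ (k i : ℝ)) * G k s := by
          rw [lintegral_tsum fun k => ((hG k).const_mul _).aemeasurable]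
          simp only [lintegral_const_mul _ (hG _), ← ENNReal.tsum_mul_left, mul_left_comm]
      _ ≤ 2 * ∫⁻ s, 2 ^ d * ∫⁻ x : Fin d → ℝ, F (Fin.snoc (α := fun _ => ℝ) x s) := by
          gcongr with s
          exact ih (hF.comp ((measurable_snoc d).comp (measurable_const.prodMk measurable_id)))
      _ = 2 ^ (d + 1) * ∫⁻ s, ∫⁻ x : Fin d → ℝ, F (Fin.snoc (α := fun _ => ℝ) x s) := by
          rw [lintegral_const_mul' _ _ (ENNReal.pow_ne_top ENNReal.ofNat_ne_top), pow_succ']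
          ring

lemma dyadicNorm_const {d : ℕ} {q : ℝ≥0∞} (hq : 0 < q) (hq' : q ≠ ∞)
    (A : (Fin d → ℤ) → ℝ≥0∞) :
    dyadicNorm d (fun _ => q) A = (∑' n : Fin d → ℤ, A n ^ q.toReal) ^ (1 / q.toReal) := by
  have h0 : 0 < q.toReal := ENNReal.toReal_pos hq.ne' hq'
  induction d with
  | zero =>
    rw [tsum_eq_single default fun k hk => (hk (Subsingleton.elim _ _)).elim, one_div,
      ENNReal.rpow_rpow_inv h0.ne']
    exact congrArg A (Subsingleton.elim _ _)
  | succ d ih =>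
    have hinit : Fin.init (fun _ : Fin (d + 1) => q) = fun _ => q := rfl
    simp only [dyadicNorm, seqNorm_of_ne_top hq', hinit, ih, one_div,
      ENNReal.rpow_inv_rpow h0.ne']
    rw [ENNReal.tsum_snoc]

/-! ### The boundedness of the truncated Fourier transform -/

lemma dyadicPowerWeight_add_one {d : ℕ} (p : Fin d → ℝ) (n : Fin d → ℤ) :
    dyadicPowerWeight p (fun i => n i + 1) = (∏ i, 2 ^ (1 / p i)) * dyadicPowerWeight p n := by
  simp only [dyadicPowerWeight, ← Finset.prod_mul_distrib]
  refine Finset.prod_congr rfl fun i _ => ?_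
  rw [← ENNReal.two_rpow_add]
  congr 1
  push_cast
  ring

lemma dyadicPowerWeight_ne_zero {d : ℕ} (p : Fin d → ℝ) (n : Fin d → ℤ) :
    dyadicPowerWeight p n ≠ 0 :=
  Finset.prod_ne_zero_iff.2 fun _ _ => ENNReal.two_rpow_ne_zero _

lemma dyadicPowerWeight_le_powerWeight {d : ℕ} {p : Fin d → ℝ} (hp : ∀ i, 0 < p i)
    {n : Fin d → ℤ} {t : Fin d → ℝ} (ht : t ∈ dyadicBox n) :
    dyadicPowerWeight p n ≤ powerWeight p t := by
  rw [← powerWeight_two_zpow]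
  refine Finset.prod_le_prod' fun i _ => ?_
  have := hp i
  gcongr
  exact (ht i).1

lemma powerWeight_le_dyadicPowerWeight {d : ℕ} {p : Fin d → ℝ} (hp : ∀ i, 0 < p i)
    {n : Fin d → ℤ} {t : Fin d → ℝ} (ht : t ∈ dyadicBox n) :
    powerWeight p t ≤ dyadicPowerWeight p fun i => n i + 1 := by
  rw [← powerWeight_two_zpow]
  refine Finset.prod_le_prod' fun i _ => ?_
  have := hp i
  gcongr
  exact (ht i).2.le

lemma prod_two_rpow_ne_top {d : ℕ} (p : Fin d → ℝ) : ∏ i, (2 : ℝ≥0∞) ^ (1 / p i) ≠ ∞ :=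
  ENNReal.prod_ne_top fun _ _ => ENNReal.two_rpow_ne_top _

/-- The norm of the dyadic values of the rearrangement is controlled by the Lorentz norm. -/
lemma dyadicNorm_iterRearr_le_lorentzNorm {d : ℕ} {p : Fin d → ℝ} {q : Fin d → ℝ≥0∞}
    (hp : ∀ i, 0 < p i) (hq : ∀ i, 0 < q i) :
    ∃ C : ℝ≥0, ∀ f : (Fin d → ℝ) → ℂ,
      dyadicNorm d q (fun n => dyadicPowerWeight p n *
        iterRearr d (fun x => ‖f x‖ₑ) fun i => 2 ^ n i) ≤ C * lorentzNorm p q f := by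
  set K : ℝ≥0∞ := ∏ i, (2 : ℝ≥0∞) ^ (1 / p i) with hK
  set c : ℝ≥0∞ := ∏ i, (2 : ℝ≥0∞)⁻¹ ^ (1 / (q i).toReal) with hc
  have hc0 : c ≠ 0 := Finset.prod_ne_zero_iff.2 fun i _ => by
    rw [ENNReal.inv_rpow]
    exact ENNReal.inv_ne_zero.2 (ENNReal.two_rpow_ne_top _)
  have hct : c ≠ ∞ := ENNReal.prod_ne_top fun i _ => by
    rw [ENNReal.inv_rpow]
    exact ENNReal.inv_ne_top.2 (ENNReal.two_rpow_ne_zero _)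
  refine ⟨(K * c⁻¹).toNNReal, fun f => ?_⟩
  rw [ENNReal.coe_toNNReal (ENNReal.mul_ne_top (prod_two_rpow_ne_top p) (ENNReal.inv_ne_top.2 hc0))]
  set R := iterRearr d (fun x => ‖f x‖ₑ) with hR
  -- on the box of index `n`, `R` is at least its value at the upper corner
  have hL : c * dyadicNorm d q (fun n => dyadicPowerWeight p n * R fun i => 2 ^ (n i + 1)) ≤
      lorentzNorm p q f := by
    refine dyadicNorm_le_mixedNorm hq fun n t ht => mul_le_mul'
      (dyadicPowerWeight_le_powerWeight hp ht) (iterRearr_antitone _ fun i => (ht i).2.le)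
  rw [← dyadicNorm_comp_equiv q (fun _ => Equiv.addRight (1 : ℤ))]
  simp only [Equiv.coe_addRight, dyadicPowerWeight_add_one, mul_assoc]
  rw [dyadicNorm_const_mul hq, ← hK]
  gcongr
  rwa [mul_comm c⁻¹, ← div_eq_mul_inv, ENNReal.le_div_iff_mul_le (Or.inl hc0) (Or.inl hct),
    mul_comm _ c]

lemma decayWeight_eq_one {k : ℕ} {x : ℝ} (hx : |x| ≤ 2 ^ k) : decayWeight (-k) x = 1 := by
  refine min_eq_left ?_
  rw [ENNReal.le_div_iff_mul_le (Or.inr two_ne_zero) (Or.inr ENNReal.ofNat_ne_top), one_mul,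
    ← ENNReal.ofReal_two_zpow, Real.enorm_eq_ofReal_abs, ← ENNReal.ofReal_mul (by positivity),
    ← ENNReal.ofReal_ofNat 2]
  refine ENNReal.ofReal_le_ofReal ?_
  rw [zpow_neg, zpow_natCast, inv_mul_le_iff₀ (by positivity)]
  have : (0 : ℝ) < 2 ^ k := by positivity
  linarith

lemma integrableOn_centredCube {d : ℕ} {f : (Fin d → ℝ) → ℂ} (hf : AEMeasurable f volume)
    (h : ∀ n : Fin d → ℤ, ∫⁻ x, ‖f x‖ₑ * ∏ i, decayWeight (n i) (x i) < ∞) (N : ℝ) :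
    IntegrableOn f (centredCube d N) volume := by
  obtain ⟨k, hk⟩ := pow_unbounded_of_one_lt (N / 2) (one_lt_two (α := ℝ))
  refine ⟨hf.aestronglyMeasurable.restrict, lt_of_le_of_lt ?_ (h fun _ => -k)⟩
  refine le_trans (le_of_eq ?_) (setLIntegral_le_lintegral (centredCube d N) _)
  refine setLIntegral_congr_fun measurableSet_Icc fun x hx => ?_
  have : ∀ i, decayWeight (-k) (x i) = 1 := fun i =>
    decayWeight_eq_one ((abs_le.2 ⟨hx.1 i, hx.2 i⟩).trans hk.le)
  simp [this]

/-- The main estimate, between the dyadic values of the rearrangement of `f` and those of the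
averages of its truncated Fourier transforms. -/
lemma dyadicNorm_netAverage_le {d : ℕ} {p : Fin d → ℝ} {q : Fin d → ℝ≥0∞}
    (hp : ∀ i, 1 < p i) (hq : ∀ i, 0 < q i) :
    ∃ C : ℝ≥0, ∀ N : ℝ, ∀ f : (Fin d → ℝ) → ℂ, AEMeasurable f volume →
      dyadicNorm d q (fun n => dyadicPowerWeight p n *
        iterRearr d (fun x => ‖f x‖ₑ) fun i => 2 ^ n i) < ∞ →
      IntegrableOn f (centredCube d N) volume ∧
      dyadicNorm d q (fun n => (dyadicPowerWeight (fun i => p i / (p i - 1)) fun i => n i + 1) *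
        netAverage (truncFourier N f) fun i => 2 ^ n i) ≤
      C * dyadicNorm d q (fun n => dyadicPowerWeight p n *
        iterRearr d (fun x => ‖f x‖ₑ) fun i => 2 ^ n i) := by
  obtain ⟨C, hC⟩ := dyadicNorm_lintegral_decayWeight_le hp hq
  set K : ℝ≥0∞ := ∏ i, (2 : ℝ≥0∞) ^ (1 / (p i / (p i - 1))) with hK
  have hKt : K ≠ ∞ := prod_two_rpow_ne_top _
  refine ⟨K.toNNReal * C, fun N f hf hfin => ?_⟩
  set B := dyadicNorm d q (fun n => dyadicPowerWeight p n *
    iterRearr d (fun x => ‖f x‖ₑ) fun i => 2 ^ n i) with hB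
  -- neither side changes when `f` is replaced by a Borel representative
  have hae : (fun x => ‖f x‖ₑ) =ᵐ[volume] fun x => ‖hf.mk f x‖ₑ := by
    filter_upwards [hf.ae_eq_mk] with x hx
    rw [hx]
  have hV : dyadicNorm d q (fun n => dyadicPowerWeight (fun i => p i / (p i - 1)) n *
      ∫⁻ x, ‖f x‖ₑ * ∏ i, decayWeight (n i) (x i)) ≤ C * B := by
    have h1 : ∀ n : Fin d → ℤ, ∫⁻ x, ‖f x‖ₑ * ∏ i, decayWeight (n i) (x i) =
        ∫⁻ x, ‖hf.mk f x‖ₑ * ∏ i, decayWeight (n i) (x i) := fun n => by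
      refine lintegral_congr_ae ?_
      filter_upwards [hae] with x hx
      rw [hx]
    simp only [hB, h1, iterRearr_congr_ae hae]
    exact hC _ hf.measurable_mk.enorm
  have hint : IntegrableOn f (centredCube d N) volume := by
    refine integrableOn_centredCube hf (fun n => ?_) N
    have h2 := ((le_dyadicNorm hq _ n).trans hV).trans_lt
      (ENNReal.mul_lt_top ENNReal.coe_lt_top hfin)
    refine lt_top_iff_ne_top.2 fun h3 => h2.ne ?_
    rw [h3, ENNReal.mul_top (dyadicPowerWeight_ne_zero _ n)]
  refine ⟨hint, ?_⟩
  simp only [dyadicPowerWeight_add_one, mul_assoc]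
  rw [dyadicNorm_const_mul hq, ENNReal.coe_mul, ENNReal.coe_toNNReal hKt, mul_assoc, ← hK]
  gcongr
  refine (dyadicNorm_mono fun n => ?_).trans hV
  gcongr
  exact netAverage_truncFourier_le hint n

lemma dyadicBox_eq_pi {d : ℕ} (n : Fin d → ℤ) :
    dyadicBox n = Set.univ.pi fun i => Set.Ico ((2 : ℝ) ^ n i) (2 ^ (n i + 1)) := by
  ext t
  simp [dyadicBox]

lemma measurableSet_dyadicBox {d : ℕ} (n : Fin d → ℤ) : MeasurableSet (dyadicBox n) := by
  rw [dyadicBox_eq_pi]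
  exact MeasurableSet.univ_pi fun i => measurableSet_Ico

lemma volume_dyadicBox {d : ℕ} (n : Fin d → ℤ) :
    volume (dyadicBox n) = ∏ i, (2 : ℝ≥0∞) ^ (n i : ℝ) := by
  rw [dyadicBox_eq_pi, volume_pi_pi]
  simp only [volume_Ico_two_zpow, ENNReal.ofReal_two_zpow]

/-- The weighted `L_p` norm of an antitone function is bounded by that of its dyadic values. -/
lemma lintegral_rpow_le_dyadicNorm {d : ℕ} {p : ℝ} (hp : 1 < p) {G : (Fin d → ℝ) → ℝ≥0∞}
    (hG : Antitone G) :
    (∫⁻ t in {t : Fin d → ℝ | ∀ i, 0 < t i}, ENNReal.ofReal (∏ i, t i) ^ (p - 2) * G t ^ p) ^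
        (1 / p) ≤
      dyadicNorm d (fun _ => ENNReal.ofReal p) fun n =>
        (dyadicPowerWeight (fun _ => p / (p - 1)) fun i => n i + 1) * G fun i => 2 ^ n i := by
  have hp0 : 0 < p := by linarith
  rw [dyadicNorm_const (by simpa using hp0) ENNReal.ofReal_ne_top,
    ENNReal.toReal_ofReal hp0.le]
  gcongr
  have hsub : {t : Fin d → ℝ | ∀ i, 0 < t i} ⊆ ⋃ n : Fin d → ℤ, dyadicBox n := by
    intro t ht
    choose n hn using fun i => exists_mem_Ico_zpow (ht i) (one_lt_two (α := ℝ))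
    exact Set.mem_iUnion.2 ⟨n, hn⟩
  refine (lintegral_mono_set hsub).trans ((lintegral_iUnion_le _ _).trans ?_)
  refine ENNReal.tsum_le_tsum fun n => ?_
  have hbound : ∀ t ∈ dyadicBox n, ENNReal.ofReal (∏ i, t i) ^ (p - 2) * G t ^ p ≤
      (∏ i, ((2 : ℝ≥0∞) ^ (n i : ℝ))⁻¹ * 2 ^ ((n i + 1) * (p - 1))) *
        G (fun i => 2 ^ n i) ^ p := by
    intro t ht
    have ht0 : ∀ i, 0 < t i := fun i => lt_of_lt_of_le (by positivity) (ht i).1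
    rw [ENNReal.ofReal_prod_of_nonneg fun i _ => (ht0 i).le,
      ← ENNReal.prod_rpow_of_ne_top fun i _ => ENNReal.ofReal_ne_top]
    refine mul_le_mul' (Finset.prod_le_prod' fun i _ => ?_)
      (ENNReal.rpow_le_rpow (hG fun i => (ht i).1) hp0.le)
    -- `t^{p-2} = t^{-1} t^{p-1}`, whatever the sign of `p - 2`
    rw [show p - 2 = -1 + (p - 1) by ring,
      ENNReal.rpow_add _ _ (by simpa using ht0 i) ENNReal.ofReal_ne_top, ENNReal.rpow_neg_one]
    refine mul_le_mul' (ENNReal.inv_le_inv.2 ?_) ?_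
    · rw [← ENNReal.ofReal_two_zpow]
      exact ENNReal.ofReal_le_ofReal (ht i).1
    · rw [ENNReal.rpow_mul, show (n i : ℝ) + 1 = ((n i + 1 : ℤ) : ℝ) by push_cast; rfl,
        ← ENNReal.ofReal_two_zpow]
      exact ENNReal.rpow_le_rpow (ENNReal.ofReal_le_ofReal (ht i).2.le) (by linarith)
  refine (setLIntegral_mono' (measurableSet_dyadicBox n) hbound).trans (le_of_eq ?_)
  rw [setLIntegral_const, volume_dyadicBox, ENNReal.mul_rpow_of_nonneg _ _ hp0.le,
    mul_right_comm, ← Finset.prod_mul_distrib]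
  congr 1
  rw [dyadicPowerWeight, ← ENNReal.prod_rpow_of_nonneg hp0.le]
  refine Finset.prod_congr rfl fun i _ => ?_
  rw [mul_right_comm, ENNReal.inv_mul_cancel (ENNReal.two_rpow_ne_zero _)
    (ENNReal.two_rpow_ne_top _), one_mul, ← ENNReal.rpow_mul]
  congr 1
  have h1 : p - 1 ≠ 0 := by linarith
  push_cast
  field_simp

lemma dyadicNorm_iterRearr_le_eLpNorm {d : ℕ} {p : ℝ} (hp : 0 < p) {f : (Fin d → ℝ) → ℂ}
    (hf : AEMeasurable f volume) :
    dyadicNorm d (fun _ => ENNReal.ofReal p) (fun n => dyadicPowerWeight (fun _ => p) n *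
        iterRearr d (fun x => ‖f x‖ₑ) fun i => 2 ^ n i) ≤
      (2 ^ d) ^ (1 / p) * eLpNorm f (ENNReal.ofReal p) volume := by
  have hp' : ENNReal.ofReal p ≠ 0 := by simpa using hp
  have hae : (fun x => ‖f x‖ₑ) =ᵐ[volume] fun x => ‖hf.mk f x‖ₑ := by
    filter_upwards [hf.ae_eq_mk] with x hx
    rw [hx]
  rw [eLpNorm_congr_ae hf.ae_eq_mk,
    eLpNorm_eq_lintegral_rpow_enorm_toReal hp' ENNReal.ofReal_ne_top,
    dyadicNorm_const (pos_iff_ne_zero.2 hp') ENNReal.ofReal_ne_top, ENNReal.toReal_ofReal hp.le,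
    ← ENNReal.mul_rpow_of_nonneg _ _ (by positivity)]
  gcongr
  refine le_trans (le_of_eq ?_)
    (tsum_iterRearr_le_lintegral (hf.measurable_mk.enorm.pow_const p))
  congr 1
  ext n
  rw [iterRearr_congr_ae hae, ENNReal.mul_rpow_of_nonneg _ _ hp.le, iterRearr_rpow _ hp,
    dyadicPowerWeight, ← ENNReal.prod_rpow_of_nonneg hp.le]
  simp only [← ENNReal.rpow_mul, mul_assoc, one_div_mul_cancel hp.ne', mul_one]

theorem theorem3p1 (d : ℕ) :
    (∀ (p : Fin d → ℝ) (q : Fin d → ℝ≥0∞), (∀ i, 1 < p i) → (∀ i, 0 < q i) →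
      ∃ C : ℝ≥0, ∀ N : ℝ, 0 < N → ∀ f : (Fin d → ℝ) → ℂ, MemLorentz p q f →
        IntegrableOn f (centredCube d N) volume ∧
        MemNet (fun i => p i / (p i - 1)) q (truncFourier N f) ∧
        netNorm (fun i => p i / (p i - 1)) q (truncFourier N f) ≤ C * lorentzNorm p q f) ∧
    (∀ p : ℝ, 1 < p →
      ∃ C : ℝ≥0, ∀ N : ℝ, 0 < N → ∀ f : (Fin d → ℝ) → ℂ,
        MemLp f (ENNReal.ofReal p) volume →
        (∫⁻ t in {t : Fin d → ℝ | ∀ i, 0 < t i},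
            ENNReal.ofReal (∏ i, t i) ^ (p - 2) * netAverage (truncFourier N f) t ^ p) ^ (1 / p)
          ≤ C * eLpNorm f (ENNReal.ofReal p) volume) := by
  refine ⟨fun p q hp hq => ?_, fun p hp => ?_⟩
  · obtain ⟨C, hC⟩ := dyadicNorm_netAverage_le hp hq
    obtain ⟨C', hC'⟩ := dyadicNorm_iterRearr_le_lorentzNorm (fun i => one_pos.trans (hp i)) hq
    refine ⟨C * C', fun N _ f hf => ?_⟩
    obtain ⟨hint, hD⟩ := hC N f hf.1
      ((hC' f).trans_lt (ENNReal.mul_lt_top ENNReal.coe_lt_top hf.2))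
    have hp' : ∀ i, 0 < p i / (p i - 1) := fun i =>
      div_pos (one_pos.trans (hp i)) (sub_pos.2 (hp i))
    have hnorm : netNorm (fun i => p i / (p i - 1)) q (truncFourier N f) ≤
        (C * C' : ℝ≥0) * lorentzNorm p q f := by
      rw [ENNReal.coe_mul, mul_assoc]
      refine (mixedNorm_le_dyadicNorm fun n t ht => ?_).trans
        (hD.trans (mul_le_mul_right (hC' f) _))
      exact mul_le_mul' (powerWeight_le_dyadicPowerWeight hp' ht)
        (netAverage_antitone _ fun i => (ht i).1)
    have hcont := continuous_truncFourier hint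
    exact ⟨hint, ⟨hcont.measurable.aemeasurable, hcont.locallyIntegrable,
      hnorm.trans_lt (ENNReal.mul_lt_top ENNReal.coe_lt_top hf.2)⟩, hnorm⟩
  · have hp0 : 0 < p := one_pos.trans hp
    obtain ⟨C, hC⟩ := dyadicNorm_netAverage_le (d := d) (p := fun _ => p)
      (q := fun _ => ENNReal.ofReal p) (fun _ => hp) (fun _ => by simpa using hp0)
    have hK : ((2 : ℝ≥0∞) ^ d) ^ (1 / p) ≠ ∞ :=
      ENNReal.rpow_ne_top_of_nonneg (by positivity) (ENNReal.pow_ne_top ENNReal.ofNat_ne_top)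
    refine ⟨C * (((2 : ℝ≥0∞) ^ d) ^ (1 / p)).toNNReal, fun N _ f hf => ?_⟩
    have hfm := hf.1.aemeasurable
    have hB := dyadicNorm_iterRearr_le_eLpNorm hp0 hfm
    obtain ⟨-, hD⟩ := hC N f hfm
      (hB.trans_lt (ENNReal.mul_lt_top (lt_top_iff_ne_top.2 hK) hf.2))
    rw [ENNReal.coe_mul, ENNReal.coe_toNNReal hK, mul_assoc]
    exact (lintegral_rpow_le_dyadicNorm hp (netAverage_antitone _)).trans
      (hD.trans (mul_le_mul_right hB _))
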